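/- **Conventions.** All monoids are commutative. A weakly toric monoid $P$ is a finitely generated, cancellative, saturated monoid with torsion-free group completion $P^{\rm gp}$, and $X_P$ is the space of monoid morphisms $x:P\to([0,\infty),\cdot)$ with the weakest topology making all $\lambda_p:x\mapsto x(p)$, $p\in P$, continuous. Its interior is $X_P^\circ=\{x:x(p)>0\ \forall p\}$, and the depth of $x\in X_P$ is $\operatorname{rank}P-\operatorname{rank}\{p\in P:x(p)\neq 0\}$. For $U\subseteq X_P$ open, a function $U\to\mathbb R$ is smooth if it is locally of the form $g(\lambda_{r_1},\dots,\lambda_{r_n})$ with $r_i\in P$ and $g$ smooth; a function $U\to[0,\infty)$ is smooth if locally it is either $\lambda_p\cdot h$ with $p\in P$ and $h>0$ smooth, or $0$; a continuous map $f:U\to V$ with $V\subseteq X_Q$ open is smooth if $\lambda_q\circ f:U\to[0,\infty)$ is smooth for all $q\in Q$. A manifold with g-corners is a second countable Hausdorff space with a maximal atlas of charts homeomorphic to open subsets of spaces $X_P$, with $P$ weakly toric of one fixed rank, and with smooth transition maps. A continuous map of manifolds with g-corners is smooth if it is smooth in charts; a smooth map is interior if in charts it maps interior points to interior points. Depth is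 well defined on a manifold with g-corners $X$; write $S^k(X)=\{x\in X:\operatorname{depth}x=k\}$. For $x\in X$ let $C^\infty_x(X)$ be the algebra of germs at $x$ of smooth functions $X\to\mathbb R$, and $\mathcal I_x(X)$ the multiplicative monoid of germs at $x$ of interior maps $X\to[0,\infty)$. Let ${}^bT_xX$ be the vector space of pairs $(v,v')$ of a linear map $v:C^\infty_x(X)\to\mathbb R$ with $v(ab)=v(a)b(x)+a(x)v(b)$ and a monoid morphism $v':\mathcal I_x(X)\to(\mathbb R,+)$ with $v'(\exp a)=v(a)$ for $a\in C^\infty_x(X)$ and $v(b)=b(x)v'(b)$ for $b\in\mathcal I_x(X)$. Let ${}^b\tilde N_xX$ and $\tilde M_xX$ be the vector space, respectively monoid, of monoid morphisms from $\mathcal I_x(X)$ to $(\mathbb R,+)$, respectively $(\mathbb N,+)$, vanishing on germs $b$ with $b(x)>0$. An interior map $f$ with $f(x)=y$ induces ${}^bT_xf:{}^bT_xX\to{}^bT_yY$, ${}^b\tilde N_xf:{}^b\tilde N_xX\to{}^b\tilde N_yY$ and $\tilde M_xf:\tilde M_xX\to\tilde M_yY$ by composition with the pullback of germs. A local $k$-corner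 component $\gamma$ of $X$ at $x$ is a choice, for each sufficiently small open $V\ni x$, of a connected component $W$ of $V\cap S^k(X)$ with $x\in\overline W$, such that $x\in\overline{W\cap W'}$ for any two such choices $W,W'$; $C_k(X)$ is the set of all such pairs $(x,\gamma)$. A smooth map $f:X\to Y$ induces $C(f):\coprod_kC_k(X)\to\coprod_lC_l(Y)$, $(x,\gamma)\mapsto(f(x),f_*\gamma)$, where $f_*\gamma$ is the unique local corner component at $f(x)$ whose component $\tilde W$ of $\tilde V\cap S^l(Y)$ meets $f(W)$ for all sufficiently small $V\ni x$, $\tilde V\ni f(x)$. A smooth map $f$ is b-normal if $C(f)$ maps $C_k(X)$ into $\coprod_{j=0}^kC_j(Y)$ for all $k\ge0$. An interior map $f$ is a b-submersion if ${}^bT_xf:{}^bT_xX\to{}^bT_{f(x)}Y$ is surjective for all $x\in X$, and a b-fibration if it is a b-normal b-submersion. Let $g:X\to Z$ and $h:Y\to Z$ be interior maps of manifolds with g-corners. They are b-transverse if ${}^bT_xg\oplus{}^bT_yh:{}^bT_xX\oplus{}^bT_yY\to{}^bT_zZ$ is surjective for all $x\in X$, $y\in Y$ with $g(x)=h(y)=z\in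 Z$. They are c-transverse if they are b-transverse and for all such $x,y,z$ the map ${}^b\tilde N_xg\oplus{}^b\tilde N_yh:{}^b\tilde N_xX\oplus{}^b\tilde N_yY\to{}^b\tilde N_zZ$ is surjective, and the submonoid $$\{(\lambda,\mu)\in\tilde M_xX\times\tilde M_yY:\tilde M_xg(\lambda)=\tilde M_yh(\mu)\}$$ is not contained in any proper face of $\tilde M_xX\times\tilde M_yY$ (a face of a monoid $M$ is a submonoid $F$ such that $p+q\in F$ implies $p,q\in F$). **Proposition.** Let $g:X\to Z$ and $h:Y\to Z$ be interior maps of manifolds with g-corners. Then $g,h$ are c-transverse if either (i) $g,h$ are b-transverse, and $g$ or $h$ is b-normal; or (ii) $g$ or $h$ is a b-fibration. -/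

import Mathlib

open Filter Topology Set
open scoped NNReal ContDiff

noncomputable section

namespace GCorners

universe u v w

/-! ## Weakly toric monoids and their model spaces

Weakly toric monoids are taken, as usual for g-charts, inside some `ℤ^k`, so that they are
automatically cancellative and torsion-free, and `P^gp` is the subgroup of `ℤ^k` generated by `P`. -/

/-- A submonoid `P` of `ℤ^k` is weakly toric if it is finitely generated and saturated in
the group `P^gp` which it generates. -/
structure IsWeaklyToric {k : ℕ} (P : AddSubmonoid (Fin k → ℤ)) : Prop where
  fg : P.FG
  saturated : ∀ a ∈ AddSubgroup.closure (P : Set (Fin k → ℤ)), ∀ n : ℕ, 1 ≤ n → n • a ∈ P → a ∈ P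

/-- The rank of the subgroup of `ℤ^k` generated by `S`; for a submonoid `S` this is `rank S^gp`. -/
def gpRank {k : ℕ} (S : Set (Fin k → ℤ)) : ℕ :=
  Module.finrank ℤ (AddSubgroup.closure S)

/-- The model space `X_P` of monoid morphisms `P → ([0,∞),·)`. -/
def Model {k : ℕ} (P : AddSubmonoid (Fin k → ℤ)) : Type :=
  Multiplicative P →* ℝ≥0

namespace Model

variable {k l : ℕ} {P : AddSubmonoid (Fin k → ℤ)} {Q : AddSubmonoid (Fin l → ℤ)}

/-- The function `λ_p : X_P → [0,∞)`, `λ_p(x) = x(p)`, as a real-valued function. -/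
def lam (p : P) (x : Model P) : ℝ :=
  ((show Multiplicative P →* ℝ≥0 from x) (Multiplicative.ofAdd p) : ℝ)

/-- The weakest topology for which all `λ_p` are continuous. -/
instance : TopologicalSpace (Model P) :=
  TopologicalSpace.induced (fun x p => lam p x) (inferInstance : TopologicalSpace (P → ℝ))

lemma continuous_lam (p : P) : Continuous (lam p : Model P → ℝ) :=
  (continuous_apply (A := fun _ : P => ℝ) p).comp
    (continuous_induced_dom (f := fun (x : Model P) p => lam p x))

lemma lam_nonneg (p : P) (x : Model P) : 0 ≤ lam p x := NNReal.coe_nonneg _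

lemma lam_zero (x : Model P) : lam 0 x = 1 := by
  unfold lam
  have : Multiplicative.ofAdd (0 : P) = 1 := rfl
  rw [this, map_one]; rfl

lemma lam_add (p q : P) (x : Model P) : lam (p + q) x = lam p x * lam q x := by
  unfold lam
  rw [ofAdd_add, map_mul, NNReal.coe_mul]

/-- The interior `X_P°` of `X_P`. -/
def interior (P : AddSubmonoid (Fin k → ℤ)) : Set (Model P) := {x | ∀ p, 0 < lam p x}

/-- The support `{p ∈ P : x(p) ≠ 0}` of `x ∈ X_P`, a face of `P`. -/
def supp (x : Model P) : Set (Fin k → ℤ) := {a | ∃ h : a ∈ P, lam ⟨a, h⟩ x ≠ 0}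

/-- The depth of `x` in `X_P`, the codimension of the face `supp x`. -/
def depth (x : Model P) : ℕ := gpRank (P : Set (Fin k → ℤ)) - gpRank (supp x)

/-- A function `f : U → ℝ` is smooth if `f(x) = g(x(r₁),…,x(rₙ))` on `U` for some `r₁,…,rₙ ∈ P`
and some smooth `g`. -/
def SmoothRealOn (U : Set (Model P)) (f : Model P → ℝ) : Prop :=
  ∃ (n : ℕ) (r : Fin n → P) (W : Set (Fin n → ℝ)) (g : (Fin n → ℝ) → ℝ),
    IsOpen W ∧ ContDiffOn ℝ ∞ g W ∧
      ∀ x ∈ U, (fun i => lam (r i) x) ∈ W ∧ f x = g (fun i => lam (r i) x)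

/-- `f` is a smooth real function on a neighbourhood of `u`. -/
def SmoothRealAt (f : Model P → ℝ) (u : Model P) : Prop :=
  ∃ U : Set (Model P), IsOpen U ∧ u ∈ U ∧ SmoothRealOn U f

/-- `f` is near `u` a smooth function to `[0,∞)`: either `λ_p · h` with `h > 0` smooth, or zero. -/
def SmoothNonnegAt (f : Model P → ℝ) (u : Model P) : Prop :=
  ∃ U : Set (Model P), IsOpen U ∧ u ∈ U ∧
    ((∃ (p : P) (h : Model P → ℝ), SmoothRealOn U h ∧ ∀ x ∈ U, 0 < h x ∧ f x = lam p x * h x) ∨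
      ∀ x ∈ U, f x = 0)

/-- `F : U → X_Q` is smooth if it is continuous and every `λ_q ∘ F` is a smooth function
to `[0,∞)`. -/
def SmoothMapOn (U : Set (Model P)) (F : Model P → Model Q) : Prop :=
  ContinuousOn F U ∧ ∀ q : Q, ∀ u ∈ U, SmoothNonnegAt (fun x => lam q (F x)) u

lemma SmoothRealOn.mono {U V : Set (Model P)} {f : Model P → ℝ} (h : SmoothRealOn U f)
    (hVU : V ⊆ U) : SmoothRealOn V f := by
  obtain ⟨n, r, W, g, hW, hg, H⟩ := h
  exact ⟨n, r, W, g, hW, hg, fun x hx => H x (hVU hx)⟩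

lemma SmoothRealAt.congr {f f' : Model P → ℝ} {u : Model P} (h : SmoothRealAt f u)
    (hff : f' =ᶠ[𝓝 u] f) : SmoothRealAt f' u := by
  obtain ⟨U, hU, hu, n, r, W, g, hW, hg, H⟩ := h
  obtain ⟨V, hV, hVo, huV⟩ := eventually_nhds_iff.1 hff
  exact ⟨U ∩ V, hU.inter hVo, ⟨hu, huV⟩, n, r, W, g, hW, hg,
    fun x hx => ⟨(H x hx.1).1, (hV x hx.2).trans (H x hx.1).2⟩⟩

lemma SmoothNonnegAt.congr {f f' : Model P → ℝ} {u : Model P} (h : SmoothNonnegAt f u)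
    (hff : f' =ᶠ[𝓝 u] f) : SmoothNonnegAt f' u := by
  obtain ⟨U, hU, hu, H⟩ := h
  obtain ⟨V, hV, hVo, huV⟩ := eventually_nhds_iff.1 hff
  refine ⟨U ∩ V, hU.inter hVo, ⟨hu, huV⟩, ?_⟩
  rcases H with ⟨p, h, hh, H⟩ | H
  · exact Or.inl ⟨p, h, hh.mono inter_subset_left,
      fun x hx => ⟨(H x hx.1).1, (hV x hx.2).trans (H x hx.1).2⟩⟩
  · exact Or.inr fun x hx => (hV x hx.2).trans (H x hx.1)

/-- Composing smooth real functions with a smooth function of several variables. -/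
lemma smoothRealAt_comp {m : ℕ} {f : Fin m → Model P → ℝ} {u : Model P}
    (hf : ∀ i, SmoothRealAt (f i) u) {W : Set (Fin m → ℝ)} {G : (Fin m → ℝ) → ℝ} (hW : IsOpen W)
    (hG : ContDiffOn ℝ ∞ G W) (hu : (fun i => f i u) ∈ W) :
    SmoothRealAt (fun x => G (fun i => f i x)) u := by
  choose U hU huU n r W' g hW' hg H using hf
  let e := Fintype.equivFin (Σ i, Fin (n i))
  let pr : ∀ i, (Fin (Fintype.card (Σ i, Fin (n i))) → ℝ) → (Fin (n i) → ℝ) :=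
    fun i y j => y (e ⟨i, j⟩)
  have hpr : ∀ i, ContDiff ℝ ∞ (pr i) := fun i => contDiff_pi.2 fun j => contDiff_apply _ _ _
  let O : Set (Fin (Fintype.card (Σ i, Fin (n i))) → ℝ) := ⋂ i, pr i ⁻¹' W' i
  have hO : IsOpen O := isOpen_iInter_of_finite fun i => (hW' i).preimage (hpr i).continuous
  let K : (Fin (Fintype.card (Σ i, Fin (n i))) → ℝ) → (Fin m → ℝ) := fun y i => g i (pr i y)
  have hK : ContDiffOn ℝ ∞ K O := contDiffOn_pi.2 fun i =>
    (hg i).comp (hpr i).contDiffOn fun y hy => mem_iInter.1 hy i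
  let r' : Fin (Fintype.card (Σ i, Fin (n i))) → P := fun j => r (e.symm j).1 (e.symm j).2
  have hprr : ∀ i x, pr i (fun j => lam (r' j) x) = fun j => lam (r i j) x := by
    intro i x
    funext j
    have hj : ∀ s : Σ i, Fin (n i), e.symm (e s) = s := e.symm_apply_apply
    change lam (r (e.symm (e ⟨i, j⟩)).1 (e.symm (e ⟨i, j⟩)).2) x = _
    rw [hj]
  have hOW : IsOpen (O ∩ K ⁻¹' W) := hK.continuousOn.isOpen_inter_preimage hO hW
  have hKx : ∀ x, (∀ i, x ∈ U i) → K (fun j => lam (r' j) x) = fun i => f i x := by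
    intro x hx
    funext i
    simp only [K]
    rw [hprr, ← (H i x (hx i)).2]
  have hcont : Continuous fun x : Model P => fun j => lam (r' j) x :=
    continuous_pi fun j => continuous_lam _
  refine ⟨(⋂ i, U i) ∩ (fun x => fun j => lam (r' j) x) ⁻¹' (O ∩ K ⁻¹' W),
    (isOpen_iInter_of_finite hU).inter (hOW.preimage hcont), ⟨mem_iInter.2 huU, ?_, ?_⟩,
    _, r', O ∩ K ⁻¹' W, fun y => G (K y), hOW,
    hG.comp (hK.mono inter_subset_left) fun y hy => hy.2, ?_⟩
  · exact mem_iInter.2 fun i => by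
      rw [mem_preimage, hprr]
      exact (H i u (huU i)).1
  · rw [mem_preimage, hKx u huU]
    exact hu
  · rintro x ⟨hx, hx'⟩
    exact ⟨hx', congrArg G (hKx x (mem_iInter.1 hx)).symm⟩

lemma smoothRealAt_const (c : ℝ) (u : Model P) : SmoothRealAt (fun _ => c) u :=
  smoothRealAt_comp (m := 0) (f := fun _ _ => 0) (W := univ) (G := fun _ => c) (fun i => i.elim0)
    isOpen_univ contDiffOn_const (mem_univ _)

lemma smoothRealAt_lam (p : P) (u : Model P) : SmoothRealAt (lam p) u :=
  ⟨univ, isOpen_univ, mem_univ _, 1, fun _ => p, univ, fun y => y 0, isOpen_univ,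
    (contDiff_apply _ _ _).contDiffOn, fun _ _ => ⟨mem_univ _, rfl⟩⟩

lemma SmoothRealAt.comp₁ {f : Model P → ℝ} {u : Model P} (hf : SmoothRealAt f u) {G : ℝ → ℝ}
    (hG : ContDiff ℝ ∞ G) : SmoothRealAt (fun x => G (f x)) u :=
  smoothRealAt_comp (m := 1) (f := fun _ => f) (W := univ) (G := fun y => G (y 0)) (fun _ => hf)
    isOpen_univ (hG.comp (contDiff_apply _ _ _)).contDiffOn (mem_univ _)

lemma SmoothRealAt.comp₂ {f f' : Model P → ℝ} {u : Model P} (hf : SmoothRealAt f u)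
    (hf' : SmoothRealAt f' u) {G : ℝ × ℝ → ℝ} (hG : ContDiff ℝ ∞ G) :
    SmoothRealAt (fun x => G (f x, f' x)) u :=
  smoothRealAt_comp (m := 2) (f := ![f, f']) (W := univ) (G := fun y => G (y 0, y 1))
    (fun i => by fin_cases i <;> assumption)
    isOpen_univ (hG.comp ((contDiff_apply _ _ _).prodMk (contDiff_apply _ _ _))).contDiffOn
    (mem_univ _)

lemma SmoothRealAt.mul {f f' : Model P → ℝ} {u : Model P} (hf : SmoothRealAt f u)
    (hf' : SmoothRealAt f' u) : SmoothRealAt (fun x => f x * f' x) u :=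
  hf.comp₂ hf' contDiff_mul

lemma SmoothRealAt.add {f f' : Model P → ℝ} {u : Model P} (hf : SmoothRealAt f u)
    (hf' : SmoothRealAt f' u) : SmoothRealAt (fun x => f x + f' x) u :=
  hf.comp₂ hf' contDiff_add

/-- A criterion for smoothness to `[0,∞)` through smoothness of the factor at a point. -/
lemma smoothNonnegAt_of_lam_mul {f h : Model P → ℝ} {u : Model P} (p : P) (hh : SmoothRealAt h u)
    (H : ∀ᶠ x in 𝓝 u, 0 < h x ∧ f x = lam p x * h x) : SmoothNonnegAt f u := by
  obtain ⟨U, hU, hu, hUh⟩ := hh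
  obtain ⟨V, hV, hVo, huV⟩ := eventually_nhds_iff.1 H
  exact ⟨U ∩ V, hU.inter hVo, ⟨hu, huV⟩,
    Or.inl ⟨p, h, hUh.mono inter_subset_left, fun x hx => hV x hx.2⟩⟩

lemma SmoothNonnegAt.mul {f f' : Model P → ℝ} {u : Model P} (hf : SmoothNonnegAt f u)
    (hf' : SmoothNonnegAt f' u) : SmoothNonnegAt (fun x => f x * f' x) u := by
  obtain ⟨U, hU, hu, H⟩ := hf
  obtain ⟨U', hU', hu', H'⟩ := hf'
  have hn : U ∩ U' ∈ 𝓝 u := (hU.inter hU').mem_nhds ⟨hu, hu'⟩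
  have zero : (∀ x ∈ U ∩ U', f x * f' x = 0) → SmoothNonnegAt (fun x => f x * f' x) u :=
    fun h => ⟨U ∩ U', hU.inter hU', ⟨hu, hu'⟩, Or.inr h⟩
  rcases H with ⟨p, h, hh, H⟩ | H
  · rcases H' with ⟨p', h', hh', H'⟩ | H'
    · refine smoothNonnegAt_of_lam_mul (p + p')
        (SmoothRealAt.mul (f := h) (f' := h') ⟨U, hU, hu, hh⟩ ⟨U', hU', hu', hh'⟩) ?_
      filter_upwards [hn] with x hx
      refine ⟨mul_pos (H x hx.1).1 (H' x hx.2).1, ?_⟩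
      rw [(H x hx.1).2, (H' x hx.2).2, lam_add]
      ring
    · exact zero fun x hx => by rw [H' x hx.2, mul_zero]
  · exact zero fun x hx => by rw [H x hx.1, zero_mul]

lemma SmoothNonnegAt.smoothRealAt {f : Model P → ℝ} {u : Model P} (hf : SmoothNonnegAt f u) :
    SmoothRealAt f u := by
  obtain ⟨U, hU, hu, ⟨p, h, hh, H⟩ | H⟩ := hf
  · refine ((smoothRealAt_lam p u).mul ⟨U, hU, hu, hh⟩).congr ?_
    filter_upwards [hU.mem_nhds hu] with x hx using (H x hx).2
  · refine (smoothRealAt_const 0 u).congr ?_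
    filter_upwards [hU.mem_nhds hu] with x hx using H x hx

/-- Pullback of smooth real functions by smooth maps. -/
lemma SmoothRealAt.pullback {U : Set (Model P)} (hU : IsOpen U) {F : Model P → Model Q}
    (hF : SmoothMapOn U F) {u : Model P} (hu : u ∈ U) {a : Model Q → ℝ}
    (ha : SmoothRealAt a (F u)) : SmoothRealAt (fun x => a (F x)) u := by
  obtain ⟨V, hV, huV, n, r, W, g, hW, hg, H⟩ := ha
  have hc : ∀ᶠ x in 𝓝 u, F x ∈ V :=
    (hF.1.continuousAt (hU.mem_nhds hu)).eventually (hV.mem_nhds huV)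
  refine (smoothRealAt_comp (f := fun i x => lam (r i) (F x))
    (fun i => (hF.2 (r i) u hu).smoothRealAt) hW hg (H _ huV).1).congr ?_
  filter_upwards [hc] with x hx using (H _ hx).2

/-- Pullback of smooth functions to `[0,∞)` by smooth maps. -/
lemma SmoothNonnegAt.pullback {U : Set (Model P)} (hU : IsOpen U) {F : Model P → Model Q}
    (hF : SmoothMapOn U F) {u : Model P} (hu : u ∈ U) {a : Model Q → ℝ}
    (ha : SmoothNonnegAt a (F u)) : SmoothNonnegAt (fun x => a (F x)) u := by
  obtain ⟨V, hV, huV, H⟩ := ha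
  have hc : ∀ᶠ x in 𝓝 u, F x ∈ V :=
    (hF.1.continuousAt (hU.mem_nhds hu)).eventually (hV.mem_nhds huV)
  rcases H with ⟨q, h, hh, H⟩ | H
  · have h1 : SmoothRealAt (fun x => h (F x)) u :=
      SmoothRealAt.pullback hU hF hu ⟨V, hV, huV, hh⟩
    have h2 : SmoothNonnegAt (fun x => h (F x)) u := by
      refine smoothNonnegAt_of_lam_mul 0 h1 ?_
      filter_upwards [hc] with x hx using ⟨(H _ hx).1, by rw [lam_zero, one_mul]⟩
    refine ((hF.2 q u hu).mul h2).congr ?_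
    filter_upwards [hc] with x hx using (H _ hx).2
  · obtain ⟨N, hN, hNo, huN⟩ := eventually_nhds_iff.1 hc
    exact ⟨N, hNo, huN, Or.inr fun x hx => H _ (hN x hx)⟩

end Model

/-! ## Manifolds with g-corners -/

/-- A g-chart `(P,U,φ)` on `X`: a homeomorphism `φ` from an open set `U ⊆ X_P` to an
open set in `X`, where `P ⊆ ℤ^k` is weakly toric. -/
structure GChart (X : Type u) [TopologicalSpace X] where
  k : ℕ
  P : AddSubmonoid (Fin k → ℤ)
  weaklyToric : IsWeaklyToric P
  φ : OpenPartialHomeomorph (Model P) X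

/-- The dimension of a g-chart. -/
def GChart.rank {X : Type u} [TopologicalSpace X] (c : GChart X) : ℕ :=
  gpRank (c.P : Set (Fin c.k → ℤ))

/-- The map `ψ⁻¹ ∘ f ∘ φ` in g-charts `φ` on `X` and `ψ` on `Y`. -/
def localRep {X : Type u} {Y : Type v} [TopologicalSpace X] [TopologicalSpace Y] (f : X → Y)
    (c : GChart X) (d : GChart Y) : Model c.P → Model d.P :=
  fun x => d.φ.symm (f (c.φ x))

/-- The domain `(f ∘ φ)⁻¹(ψ(V)) ⊆ U` of `ψ⁻¹ ∘ f ∘ φ`. -/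
def localDom {X : Type u} {Y : Type v} [TopologicalSpace X] [TopologicalSpace Y] (f : X → Y)
    (c : GChart X) (d : GChart Y) : Set (Model c.P) :=
  c.φ.source ∩ (fun x => f (c.φ x)) ⁻¹' d.φ.target

section

variable {X : Type u} {Y : Type v} [TopologicalSpace X] [TopologicalSpace Y]

lemma isOpen_localDom {f : X → Y} (hf : Continuous f) (c : GChart X) (d : GChart Y) :
    IsOpen (localDom f c d) :=
  (hf.comp_continuousOn c.φ.continuousOn).isOpen_inter_preimage c.φ.open_source d.φ.open_target

lemma mem_localDom {f : X → Y} {x : X} {c : GChart X} {d : GChart Y} (hx : x ∈ c.φ.target)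
    (hy : f x ∈ d.φ.target) : c.φ.symm x ∈ localDom f c d :=
  ⟨c.φ.map_target hx, by
    change f (c.φ (c.φ.symm x)) ∈ d.φ.target
    rwa [c.φ.right_inv hx]⟩

lemma localRep_symm {f : X → Y} {x : X} {c : GChart X} {d : GChart Y} (hx : x ∈ c.φ.target) :
    localRep f c d (c.φ.symm x) = d.φ.symm (f x) := by
  rw [localRep, c.φ.right_inv hx]

lemma chart_localRep {f : X → Y} {c : GChart X} {d : GChart Y} {t : Model c.P}
    (ht : t ∈ localDom f c d) : d.φ (localRep f c d t) = f (c.φ t) :=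
  d.φ.right_inv ht.2

end

/-- Two g-charts are compatible if the change of charts is smooth in both directions. -/
def GChart.Compatible {X : Type u} [TopologicalSpace X] (c d : GChart X) : Prop :=
  Model.SmoothMapOn (localDom id c d) (localRep id c d) ∧
    Model.SmoothMapOn (localDom id d c) (localRep id d c)

/-- A manifold with g-corners: a second countable Hausdorff space with a maximal g-atlas of
g-charts of one fixed dimension. -/
class ManifoldGC (X : Type u) [TopologicalSpace X] : Type u
    extends T2Space X, SecondCountableTopology X where
  dim : ℕ
  atlas : Set (GChart X)
  rank_eq : ∀ c ∈ atlas, c.rank = dim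
  compatible : ∀ c ∈ atlas, ∀ d ∈ atlas, c.Compatible d
  covers : ∀ x : X, ∃ c ∈ atlas, x ∈ c.φ.target
  maximal : ∀ c : GChart X, c.rank = dim → (∀ d ∈ atlas, c.Compatible d) → c ∈ atlas

section

variable {X : Type u} {Y : Type v} {Z : Type w}
  [TopologicalSpace X] [ManifoldGC X] [TopologicalSpace Y] [ManifoldGC Y]
  [TopologicalSpace Z] [ManifoldGC Z]

/-- A map is smooth if it is continuous and smooth in all g-charts. -/
structure IsSmooth (f : X → Y) : Prop where
  continuous : Continuous f
  smoothMapOn : ∀ c ∈ ManifoldGC.atlas (X := X), ∀ d ∈ ManifoldGC.atlas (X := Y),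
    Model.SmoothMapOn (localDom f c d) (localRep f c d)

variable (X Y) in
/-- Interior maps: smooth maps which in all g-charts take interior points to interior points. -/
structure InteriorMap where
  toFun : X → Y
  smooth : IsSmooth toFun
  interior : ∀ c ∈ ManifoldGC.atlas (X := X), ∀ d ∈ ManifoldGC.atlas (X := Y),
    ∀ x ∈ localDom toFun c d, x ∈ Model.interior c.P → localRep toFun c d x ∈ Model.interior d.P

instance : CoeFun (InteriorMap X Y) (fun _ => X → Y) := ⟨InteriorMap.toFun⟩

/-! ## Germs of smooth and of interior functions -/

/-- `a : X → ℝ` is smooth near `x`. -/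
def SmoothFunAt (a : X → ℝ) (x : X) : Prop :=
  ∀ c ∈ ManifoldGC.atlas (X := X), x ∈ c.φ.target →
    Model.SmoothRealAt (fun t => a (c.φ t)) (c.φ.symm x)

/-- `b` is near `x` an interior map to `[0,∞)`. -/
def InteriorFunAt (b : X → ℝ) (x : X) : Prop :=
  ∀ c ∈ ManifoldGC.atlas (X := X), x ∈ c.φ.target →
    Model.SmoothNonnegAt (fun t => b (c.φ t)) (c.φ.symm x) ∧
      ∀ᶠ t in 𝓝 (c.φ.symm x), t ∈ Model.interior c.P → 0 < b (c.φ t)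

/-- The germs at `x` of smooth functions `X → ℝ`. -/
def smoothGerms (x : X) : Submodule ℝ (Germ (𝓝 x) ℝ) where
  carrier := {γ | ∃ a : X → ℝ, (a : Germ (𝓝 x) ℝ) = γ ∧ SmoothFunAt a x}
  zero_mem' := ⟨fun _ => 0, rfl, fun _ _ _ => Model.smoothRealAt_const 0 _⟩
  add_mem' := by
    rintro _ _ ⟨a, rfl, ha⟩ ⟨b, rfl, hb⟩
    exact ⟨a + b, rfl, fun c hc hx => (ha c hc hx).add (hb c hc hx)⟩
  smul_mem' := by
    rintro r _ ⟨a, rfl, ha⟩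
    exact ⟨r • a, rfl, fun c hc hx => (Model.smoothRealAt_const r _).mul (ha c hc hx)⟩

lemma mul_mem_smoothGerms {x : X} {a b : Germ (𝓝 x) ℝ} (ha : a ∈ smoothGerms x)
    (hb : b ∈ smoothGerms x) : a * b ∈ smoothGerms x := by
  obtain ⟨a, rfl, ha⟩ := ha
  obtain ⟨b, rfl, hb⟩ := hb
  exact ⟨a * b, rfl, fun c hc hx => (ha c hc hx).mul (hb c hc hx)⟩

/-- The monoid, under multiplication, of germs at `x` of interior maps `X → [0,∞)`. -/
def interiorGerms (x : X) : Submonoid (Germ (𝓝 x) ℝ) where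
  carrier := {γ | ∃ b : X → ℝ, (b : Germ (𝓝 x) ℝ) = γ ∧ InteriorFunAt b x}
  one_mem' := ⟨fun _ => 1, rfl, fun c _ _ =>
    ⟨Model.smoothNonnegAt_of_lam_mul 0 (Model.smoothRealAt_const 1 _)
      (Eventually.of_forall fun t => ⟨one_pos, by rw [Model.lam_zero, one_mul]⟩),
      Eventually.of_forall fun _ _ => one_pos⟩⟩
  mul_mem' := by
    rintro _ _ ⟨a, rfl, ha⟩ ⟨b, rfl, hb⟩
    refine ⟨a * b, rfl, fun c hc hx => ⟨(ha c hc hx).1.mul (hb c hc hx).1, ?_⟩⟩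
    filter_upwards [(ha c hc hx).2, (hb c hc hx).2] with t h1 h2 ht using mul_pos (h1 ht) (h2 ht)

lemma interiorGerms_le_smoothGerms {x : X} {b : Germ (𝓝 x) ℝ} (hb : b ∈ interiorGerms x) :
    b ∈ smoothGerms x := by
  obtain ⟨b, rfl, hb⟩ := hb
  exact ⟨b, rfl, fun c hc hx => (hb c hc hx).1.smoothRealAt⟩

lemma exp_mem_interiorGerms {x : X} {a : Germ (𝓝 x) ℝ} (ha : a ∈ smoothGerms x) :
    a.map Real.exp ∈ interiorGerms x := by
  obtain ⟨a, rfl, ha⟩ := ha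
  refine ⟨fun y => Real.exp (a y), rfl, fun c hc hx => ⟨?_, Eventually.of_forall fun _ _ =>
    Real.exp_pos _⟩⟩
  exact Model.smoothNonnegAt_of_lam_mul 0 ((ha c hc hx).comp₁ Real.contDiff_exp)
    (Eventually.of_forall fun t => ⟨Real.exp_pos _, by rw [Model.lam_zero, one_mul]⟩)

/-- Product of smooth germs. -/
def smoothGerms.mul {x : X} (a b : smoothGerms x) : smoothGerms x :=
  ⟨a.1 * b.1, mul_mem_smoothGerms a.2 b.2⟩

/-- The inclusion of interior germs in smooth germs. -/
def inc {x : X} (b : interiorGerms x) : smoothGerms x := ⟨b.1, interiorGerms_le_smoothGerms b.2⟩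

/-- The exponential map from smooth germs to interior germs. -/
def expGerm {x : X} (a : smoothGerms x) : interiorGerms x :=
  ⟨a.1.map Real.exp, exp_mem_interiorGerms a.2⟩

lemma InteriorMap.tendsto (f : InteriorMap X Y) {x : X} {y : Y} (h : f x = y) :
    Tendsto f (𝓝 x) (𝓝 y) := h ▸ f.smooth.continuous.continuousAt

lemma SmoothFunAt.pullback (f : InteriorMap X Y) {x : X} {a : Y → ℝ}
    (ha : SmoothFunAt a (f x)) : SmoothFunAt (a ∘ f) x := by
  intro c hc hx
  obtain ⟨d, hd, hy⟩ := ManifoldGC.covers (f x)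
  have hm := mem_localDom hx hy
  have ho := isOpen_localDom f.smooth.continuous c d
  have h := ha d hd hy
  rw [← localRep_symm hx] at h
  refine (h.pullback ho (f.smooth.smoothMapOn c hc d hd) hm).congr ?_
  filter_upwards [ho.mem_nhds hm] with t ht
  rw [chart_localRep ht]; rfl

lemma InteriorFunAt.pullback (f : InteriorMap X Y) {x : X} {b : Y → ℝ}
    (hb : InteriorFunAt b (f x)) : InteriorFunAt (b ∘ f) x := by
  intro c hc hx
  obtain ⟨d, hd, hy⟩ := ManifoldGC.covers (f x)
  have hm := mem_localDom hx hy
  have ho := isOpen_localDom f.smooth.continuous c d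
  have hs := f.smooth.smoothMapOn c hc d hd
  obtain ⟨h, h'⟩ := hb d hd hy
  rw [← localRep_symm hx] at h h'
  refine ⟨(h.pullback ho hs hm).congr ?_, ?_⟩
  · filter_upwards [ho.mem_nhds hm] with t ht
    rw [chart_localRep ht]; rfl
  · filter_upwards [ho.mem_nhds hm, (hs.1.continuousAt (ho.mem_nhds hm)).eventually h']
      with t ht ht' hi
    have := ht' (f.interior c hc d hd t ht hi)
    rwa [chart_localRep ht] at this

/-- Pullback of smooth germs by an interior map `f` with `f x = y`. -/
def smoothPullback (f : InteriorMap X Y) {x : X} {y : Y} (h : f x = y) :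
    smoothGerms y →ₗ[ℝ] smoothGerms x where
  toFun a := ⟨a.1.compTendsto f (f.tendsto h), by
    subst h
    obtain ⟨_, a, rfl, ha⟩ := a
    exact ⟨a ∘ f, rfl, ha.pullback f⟩⟩
  map_add' := by
    rintro ⟨_, a, rfl, ha⟩ ⟨_, b, rfl, hb⟩
    rfl
  map_smul' := by
    rintro r ⟨_, a, rfl, ha⟩
    rfl

/-- Pullback of interior germs by an interior map `f` with `f x = y`. -/
def interiorPullback (f : InteriorMap X Y) {x : X} {y : Y} (h : f x = y) :
    interiorGerms y →* interiorGerms x where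
  toFun b := ⟨b.1.compTendsto f (f.tendsto h), by
    subst h
    obtain ⟨_, b, rfl, hb⟩ := b
    exact ⟨b ∘ f, rfl, hb.pullback f⟩⟩
  map_one' := rfl
  map_mul' := by
    rintro ⟨_, a, rfl, ha⟩ ⟨_, b, rfl, hb⟩
    rfl

lemma smoothPullback_mul (f : InteriorMap X Y) {x : X} {y : Y} (h : f x = y)
    (a b : smoothGerms y) : smoothPullback f h (smoothGerms.mul a b) =
      smoothGerms.mul (smoothPullback f h a) (smoothPullback f h b) := by
  obtain ⟨_, a, rfl, ha⟩ := a
  obtain ⟨_, b, rfl, hb⟩ := b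
  rfl

lemma smoothPullback_inc (f : InteriorMap X Y) {x : X} {y : Y} (h : f x = y)
    (b : interiorGerms y) : smoothPullback f h (inc b) = inc (interiorPullback f h b) := rfl

lemma interiorPullback_exp (f : InteriorMap X Y) {x : X} {y : Y} (h : f x = y)
    (a : smoothGerms y) :
    interiorPullback f h (expGerm a) = expGerm (smoothPullback f h a) := by
  obtain ⟨_, a, rfl, ha⟩ := a
  rfl

lemma value_smoothPullback (f : InteriorMap X Y) {x : X} {y : Y} (h : f x = y)
    (a : smoothGerms y) : (smoothPullback f h a).1.value = a.1.value := by
  subst h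
  obtain ⟨_, a, rfl, ha⟩ := a
  rfl

lemma value_interiorPullback (f : InteriorMap X Y) {x : X} {y : Y} (h : f x = y)
    (b : interiorGerms y) : (interiorPullback f h b).1.value = b.1.value :=
  value_smoothPullback f h (inc b)

/-! ## B-tangent spaces -/

/-- The b-tangent space `ᵇT_xX`: pairs `(v,v')` of a derivation `v` on smooth germs and a monoid
morphism `v'` from interior germs to `(ℝ,+)`, with `v'(exp a) = v(a)` and `v(b) = b(x) v'(b)`. -/
def bTangent (x : X) :
    Submodule ℝ ((smoothGerms x →ₗ[ℝ] ℝ) × (Additive (interiorGerms x) →+ ℝ)) where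
  carrier := {v |
    (∀ a b : smoothGerms x,
      v.1 (smoothGerms.mul a b) = v.1 a * b.1.value + a.1.value * v.1 b) ∧
    (∀ a : smoothGerms x, v.2 (Additive.ofMul (expGerm a)) = v.1 a) ∧
    (∀ b : interiorGerms x, v.1 (inc b) = b.1.value * v.2 (Additive.ofMul b))}
  zero_mem' := by simp
  add_mem' := by
    rintro v w ⟨h1, h2, h3⟩ ⟨k1, k2, k3⟩
    refine ⟨fun a b => ?_, fun a => ?_, fun b => ?_⟩
    · simp only [Prod.fst_add, LinearMap.add_apply, h1, k1]; ring
    · simp only [Prod.fst_add, Prod.snd_add, LinearMap.add_apply, AddMonoidHom.add_apply, h2, k2]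
    · simp only [Prod.fst_add, Prod.snd_add, LinearMap.add_apply, AddMonoidHom.add_apply, h3, k3]
      ring
  smul_mem' := by
    rintro r v ⟨h1, h2, h3⟩
    refine ⟨fun a b => ?_, fun a => ?_, fun b => ?_⟩
    · simp only [Prod.smul_fst, LinearMap.smul_apply, h1, smul_eq_mul]; ring
    · simp only [Prod.smul_fst, Prod.smul_snd, LinearMap.smul_apply, AddMonoidHom.smul_apply, h2]
    · simp only [Prod.smul_fst, Prod.smul_snd, LinearMap.smul_apply, AddMonoidHom.smul_apply, h3,
        smul_eq_mul]
      ring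

/-- The map `ᵇT_xf : ᵇT_xX → ᵇT_yY`, `(v,v') ↦ (v ∘ f^*, v' ∘ f^*)`, where `y = f(x)`. -/
def bTangentMap (f : InteriorMap X Y) {x : X} {y : Y} (h : f x = y) :
    bTangent x →ₗ[ℝ] bTangent y where
  toFun v := ⟨(v.1.1.comp (smoothPullback f h),
      v.1.2.comp (MonoidHom.toAdditive (interiorPullback f h))), by
    obtain ⟨⟨v, v'⟩, h1, h2, h3⟩ := v
    refine ⟨fun a b => ?_, fun a => ?_, fun b => ?_⟩
    · simp only [LinearMap.comp_apply, smoothPullback_mul]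
      rw [h1, value_smoothPullback, value_smoothPullback]
    · change v' (Additive.ofMul (interiorPullback f h (expGerm a))) = v (smoothPullback f h a)
      rw [interiorPullback_exp]
      exact h2 _
    · change v (smoothPullback f h (inc b)) =
        b.1.value * v' (Additive.ofMul (interiorPullback f h b))
      rw [smoothPullback_inc, ← value_interiorPullback f h b]
      exact h3 _⟩
  map_add' _ _ := rfl
  map_smul' _ _ := rfl

/-- A b-submersion: an interior map for which `ᵇdf` is surjective on every fibre. -/
def BSubmersion (f : InteriorMap X Y) : Prop :=
  ∀ x : X, Function.Surjective (bTangentMap f (rfl : f x = f x))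

/-! ## The spaces `ᵇÑ_xX` and the monoids `M̃_xX` -/

/-- `ᵇÑ_xX`: monoid morphisms from interior germs to `(ℝ,+)` which vanish on positive germs. -/
def bNormal (x : X) : Submodule ℝ (Additive (interiorGerms x) →+ ℝ) where
  carrier := {α | ∀ b : interiorGerms x, 0 < b.1.value → α (Additive.ofMul b) = 0}
  zero_mem' := fun _ _ => rfl
  add_mem' := fun h k b hb => by rw [AddMonoidHom.add_apply, h b hb, k b hb, add_zero]
  smul_mem' := fun r α h b hb => by rw [AddMonoidHom.smul_apply, h b hb, smul_zero]

/-- The linear map `ᵇÑ_xf : ᵇÑ_xX → ᵇÑ_yY`, `α ↦ α ∘ f^*`, where `y = f(x)`. -/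
def bNormalMap (f : InteriorMap X Y) {x : X} {y : Y} (h : f x = y) :
    bNormal x →ₗ[ℝ] bNormal y where
  toFun α := ⟨α.1.comp (MonoidHom.toAdditive (interiorPullback f h)), fun b hb =>
    α.2 (interiorPullback f h b) (by rwa [value_interiorPullback])⟩
  map_add' _ _ := rfl
  map_smul' _ _ := rfl

/-- `M̃_xX`: monoid morphisms from interior germs to `(ℕ,+)` which vanish on positive germs. -/
def cornerMonoid (x : X) : AddSubmonoid (Additive (interiorGerms x) →+ ℕ) where
  carrier := {α | ∀ b : interiorGerms x, 0 < b.1.value → α (Additive.ofMul b) = 0}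
  zero_mem' := fun _ _ => rfl
  add_mem' := fun h k b hb => by rw [AddMonoidHom.add_apply, h b hb, k b hb, add_zero]

/-- The monoid morphism `M̃_xf : M̃_xX → M̃_yY`, `α ↦ α ∘ f^*`, where `y = f(x)`. -/
def cornerMonoidMap (f : InteriorMap X Y) {x : X} {y : Y} (h : f x = y) :
    cornerMonoid x →+ cornerMonoid y where
  toFun α := ⟨α.1.comp (MonoidHom.toAdditive (interiorPullback f h)), fun b hb =>
    α.2 (interiorPullback f h b) (by rwa [value_interiorPullback])⟩
  map_zero' := rfl
  map_add' _ _ := rfl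

/-! ## Depth, local corner components and b-normal maps -/

/-- The depth of `x` in `X`, computed in a choice of g-chart around `x`. -/
def depth (x : X) : ℕ :=
  Model.depth ((Classical.choose (ManifoldGC.covers x)).φ.symm x)

variable (X) in
/-- The depth `k` stratum `S^k(X)`. -/
def stratum (k : ℕ) : Set X := {x | depth x = k}

/-- A local `k`-corner component of `X` at `x`: a choice, for each sufficiently small (that is,
contained in `dom`) open neighbourhood `V` of `x`, of a connected component of `V ∩ S^k(X)` whose
closure contains `x`, where any two choices are compatible. The points of `C_k(X)` over `x` are
these choices, two of them being identified if they agree for all sufficiently small `V`; nothing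
below depends on this identification. -/
structure LocalCorner (k : ℕ) (x : X) where
  dom : Set X
  isOpen_dom : IsOpen dom
  mem_dom : x ∈ dom
  comp : Set X → Set X
  isComponent : ∀ V, IsOpen V → x ∈ V → V ⊆ dom →
    ∃ w ∈ V ∩ stratum X k, comp V = connectedComponentIn (V ∩ stratum X k) w
  mem_closure : ∀ V, IsOpen V → x ∈ V → V ⊆ dom → x ∈ closure (comp V)
  compatible : ∀ V V', IsOpen V → x ∈ V → V ⊆ dom → IsOpen V' → x ∈ V' → V' ⊆ dom →
    x ∈ closure (comp V ∩ comp V')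

/-- `f_*(γ) = δ`: for all sufficiently small open neighbourhoods `V` of `x` and `V'` of `f(x)`,
with corresponding components `W` of `V ∩ S^k(X)` and `W'` of `V' ∩ S^l(Y)`, the set `W'`
meets `f(W)`. So the corner map `C(f)` takes `(x,γ)` to `(f(x),δ)`. -/
def CornerMapsTo (f : X → Y) {k l : ℕ} {x : X} (γ : LocalCorner k x) (δ : LocalCorner l (f x)) :
    Prop :=
  ∃ V₀ : Set X, ∃ V₀' : Set Y, IsOpen V₀ ∧ x ∈ V₀ ∧ V₀ ⊆ γ.dom ∧
    IsOpen V₀' ∧ f x ∈ V₀' ∧ V₀' ⊆ δ.dom ∧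
    ∀ V V', IsOpen V → x ∈ V → V ⊆ V₀ → IsOpen V' → f x ∈ V' → V' ⊆ V₀' →
      (δ.comp V' ∩ f '' γ.comp V).Nonempty

/-- A smooth map `f` is b-normal if `C(f)` maps `C_k(X)` to `∐_{j ≤ k} C_j(Y)` for all `k`. -/
structure BNormal (f : X → Y) : Prop where
  smooth : IsSmooth f
  corner_le : ∀ (k : ℕ) (x : X) (γ : LocalCorner k x),
    ∃ j ≤ k, ∃ δ : LocalCorner j (f x), CornerMapsTo f γ δ

/-- A b-fibration is a b-normal b-submersion. -/
def BFibration (f : InteriorMap X Y) : Prop := BNormal f ∧ BSubmersion f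

/-! ## Transversality -/

/-- b-transversality: `ᵇT_xg ⊕ ᵇT_yh` is surjective whenever `g(x) = h(y) = z`. -/
def BTransverse (g : InteriorMap X Z) (h : InteriorMap Y Z) : Prop :=
  ∀ (x : X) (y : Y) (z : Z) (hx : g x = z) (hy : h y = z),
    Function.Surjective ((bTangentMap g hx).coprod (bTangentMap h hy))

/-- A face of a commutative monoid. -/
def IsFace {M : Type*} [AddCommMonoid M] (F : AddSubmonoid M) : Prop :=
  ∀ p q : M, p + q ∈ F → p ∈ F ∧ q ∈ F

/-- The submonoid `{(l,m) ∈ M̃_xX × M̃_yY : M̃_xg(l) = M̃_yh(m)}`. -/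
def fibreMonoid (g : InteriorMap X Z) (h : InteriorMap Y Z) {x : X} {y : Y} {z : Z}
    (hx : g x = z) (hy : h y = z) : AddSubmonoid (cornerMonoid x × cornerMonoid y) where
  carrier := {p | cornerMonoidMap g hx p.1 = cornerMonoidMap h hy p.2}
  zero_mem' := by simp
  add_mem' := fun {p q} hp hq => by
    simp only [mem_ofPred_eq] at hp hq ⊢
    rw [Prod.fst_add, Prod.snd_add, map_add, map_add, hp, hq]

/-- c-transversality: `g,h` are b-transverse, and whenever `g(x) = h(y) = z`, the map
`ᵇÑ_xg ⊕ ᵇÑ_yh` is surjective and the submonoid `fibreMonoid` lies in no proper face of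
`M̃_xX × M̃_yY`. -/
structure CTransverse (g : InteriorMap X Z) (h : InteriorMap Y Z) : Prop where
  bTransverse : BTransverse g h
  bNormal_surjective : ∀ (x : X) (y : Y) (z : Z) (hx : g x = z) (hy : h y = z),
    Function.Surjective ((bNormalMap g hx).coprod (bNormalMap h hy))
  not_le_face : ∀ (x : X) (y : Y) (z : Z) (hx : g x = z) (hy : h y = z),
    ∀ F : AddSubmonoid (cornerMonoid x × cornerMonoid y), IsFace F → F ≠ ⊤ →
      ¬ fibreMonoid g h hx hy ≤ F

end

end GCorners

end

open Filter Topology Set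
open scoped NNReal ContDiff

noncomputable section

namespace GCorners

/-! Call an interior germ a unit if it is positive at the base point. In a chart every interior germ
is a unit times some `λ_p`, so the faces of the germ monoid at `x` that contain the units correspond
to faces of `P` containing the support of `x`, that is, to strata of the model adherent to `x`. The
codimension of a face `F` is the dimension of the space of morphisms to a field vanishing on `F`.

For each such face, a curve in its stratum running into `x` defines a local corner component.
Evaluating b-normality of `g` on this component shows that the pullback of `F` to the germs at `z =
g(x)` has at most the codimension of `F` (`BNormal.finrank_annih_le`). Nothing else about
b-normality is needed.

The rest is convex geometry (`GenBy.exists_posOff_comp_eq`). Under this codimension bound every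
morphism at `z` that is positive off the pullback of `F` lifts to a morphism at `x` positive off
`F`. One moves from a morphism positive off `F` towards a lift, or along the kernel of the map on
duals; either the goal is reached, or the path first hits a larger face with the same pullback, and
induction applies.

Over `ℝ`, perturbing an interior point turns this into surjectivity of `ᵇÑ_xg`. Over `ℚ`, start with
a morphism to `ℕ` at `y` that is positive on all nonunits, push it to `z` by `h`, lift it to `x` and
clear denominators. This gives an element of the fibre product that is interior in both factors.
Multiples of such an element dominate every element, so no proper face contains it. Case (ii)
reduces to case (i), because one surjective b-differential already gives b-transversality. -/

section

/-! ## Morphisms vanishing on a submonoid -/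

section

variable {K : Type*} [Field K] {A : Type*} [AddCommMonoid A]

/-- The vector space of morphisms `A → K` vanishing on `F`. -/
def annih (K : Type*) [Field K] {A : Type*} [AddCommMonoid A] (F : AddSubmonoid A) :
    Submodule K (A →+ K) where
  carrier := {α | ∀ a ∈ F, α a = 0}
  zero_mem' _ _ := rfl
  add_mem' h h' a ha := by rw [AddMonoidHom.add_apply, h a ha, h' a ha, add_zero]
  smul_mem' r α h a ha := by rw [AddMonoidHom.smul_apply, h a ha, smul_zero]

lemma mem_annih {F : AddSubmonoid A} {α : A →+ K} : α ∈ annih K F ↔ ∀ a ∈ F, α a = 0 := Iff.rfl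

lemma annih_anti {F F' : AddSubmonoid A} (h : F ≤ F') : annih K F' ≤ annih K F :=
  fun _ hα a ha => hα a (h ha)

/-- The restriction of morphisms along a submonoid. -/
def restrictHom (K : Type*) [Field K] {A : Type*} [AddCommMonoid A] (F : AddSubmonoid A) :
    (A →+ K) →ₗ[K] (F →+ K) where
  toFun f := f.comp F.subtype
  map_add' _ _ := rfl
  map_smul' _ _ := rfl

end

/-! ## Extension of morphisms to divisible groups -/

lemma exists_sub_of_mem_closure {A : Type*} [AddCommGroup A] (S : AddSubmonoid A) {x : A}
    (hx : x ∈ AddSubgroup.closure (S : Set A)) : ∃ a b : S, x = (a : A) - b := by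
  induction hx using AddSubgroup.closure_induction with
  | mem x hx => exact ⟨⟨x, hx⟩, 0, by simp⟩
  | zero => exact ⟨0, 0, by simp⟩
  | add x y _ _ hx hy =>
    obtain ⟨a, b, rfl⟩ := hx
    obtain ⟨a', b', rfl⟩ := hy
    exact ⟨a + a', b + b', by push_cast; abel⟩
  | neg x _ hx =>
    obtain ⟨a, b, rfl⟩ := hx
    exact ⟨b, a, by abel⟩

variable {K : Type*} [Field K] [CharZero K]

/-- In characteristic zero the additive group of `K` is divisible, hence injective. -/
lemma exists_extend_addMonoidHom {A : Type*} [AddCommGroup A] (H : AddSubgroup A) (f : H →+ K) :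
    ∃ F : A →+ K, ∀ x : H, F x = f x := by
  let _ : DivisibleBy K ℤ := divisibleByIntOfCharZero
  obtain ⟨F, hF⟩ := (Module.Baer.of_divisible K).extension_property_addMonoidHom H.subtype
    H.subtype_injective f
  exact ⟨F, fun x => DFunLike.congr_fun hF x⟩

/-- A morphism from a submonoid of an abelian group to a field of characteristic zero extends
to the group. -/
lemma exists_extend_of_submonoid {A : Type*} [AddCommGroup A] (S : AddSubmonoid A) (f : S →+ K) :
    ∃ F : A →+ K, ∀ x : S, F x = f x := by
  choose a b hab using fun x : AddSubgroup.closure (S : Set A) => exists_sub_of_mem_closure S x.2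
  -- Well-definedness on differences, so that the arbitrary choices of `a` and `b` do not matter.
  have key : ∀ p q r s : S, (p : A) - q = r - s → f p - f q = f r - f s := by
    intro p q r s h
    have : p + s = r + q := Subtype.ext (by
      push_cast
      rw [sub_eq_sub_iff_add_eq_add] at h
      exact h)
    have := congrArg f this
    rw [map_add, map_add] at this
    linear_combination this
  obtain ⟨F, hF⟩ := exists_extend_addMonoidHom (K := K) (AddSubgroup.closure (S : Set A))
    (AddMonoidHom.mk' (fun x => f (a x) - f (b x)) fun x y => by
      have : f (a (x + y)) - f (b (x + y)) = f (a x + a y) - f (b x + b y) := by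
        apply key
        rw [← hab]
        push_cast
        rw [hab x, hab y]
        abel
      rw [this, map_add, map_add]
      ring)
  refine ⟨F, fun x => ?_⟩
  rw [hF ⟨x, AddSubgroup.subset_closure x.2⟩]
  change f (a _) - f (b _) = _
  rw [key _ _ x 0 (by rw [← hab]; simp), map_zero, sub_zero]

/-- The restriction of morphisms from a group to a submonoid. -/
def restrictClosure (K : Type*) [Field K] {A : Type*} [AddCommGroup A] (S : AddSubmonoid A) :
    (AddSubgroup.closure (S : Set A) →ₗ[ℤ] K) →ₗ[K] (S →+ K) where
  toFun f := f.toAddMonoidHom.comp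
    (AddSubmonoid.inclusion (S := S) (T := (AddSubgroup.closure (S : Set A)).toAddSubmonoid)
      AddSubgroup.subset_closure)
  map_add' _ _ := rfl
  map_smul' _ _ := rfl

lemma restrictClosure_bijective {A : Type*} [AddCommGroup A] (S : AddSubmonoid A) :
    Function.Bijective (restrictClosure K S) := by
  constructor
  · intro f f' h
    ext ⟨x, hx⟩
    obtain ⟨a, b, hab⟩ := exists_sub_of_mem_closure S hx
    have e : (⟨x, hx⟩ : AddSubgroup.closure (S : Set A)) =
        ⟨a, AddSubgroup.subset_closure a.2⟩ - ⟨b, AddSubgroup.subset_closure b.2⟩ :=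
      Subtype.ext hab
    have ha : f ⟨a, AddSubgroup.subset_closure a.2⟩ = f' ⟨a, AddSubgroup.subset_closure a.2⟩ :=
      DFunLike.congr_fun h a
    have hb : f ⟨b, AddSubgroup.subset_closure b.2⟩ = f' ⟨b, AddSubgroup.subset_closure b.2⟩ :=
      DFunLike.congr_fun h b
    rw [e, map_sub, map_sub, ha, hb]
  · intro f
    obtain ⟨F, hF⟩ := exists_extend_of_submonoid S f
    exact ⟨(F.comp (AddSubgroup.closure (S : Set A)).subtype).toIntLinearMap,
      AddMonoidHom.ext fun x => hF x⟩

/-! ### Ranks of groups as dimensions of duals -/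

section

variable {k : ℕ}

lemma finiteDimensional_hom (S : AddSubmonoid (Fin k → ℤ)) : FiniteDimensional K (S →+ K) := by
  have : Module.Finite ℤ (AddSubgroup.closure (S : Set (Fin k → ℤ))) :=
    inferInstanceAs (Module.Finite ℤ
      (AddSubgroup.toIntSubmodule (AddSubgroup.closure (S : Set (Fin k → ℤ)))))
  have : Module.Free ℤ (AddSubgroup.closure (S : Set (Fin k → ℤ))) :=
    inferInstanceAs (Module.Free ℤ
      (AddSubgroup.toIntSubmodule (AddSubgroup.closure (S : Set (Fin k → ℤ)))))
  exact Module.Finite.of_surjective _ (restrictClosure_bijective (K := K) S).2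

lemma finrank_hom (S : AddSubmonoid (Fin k → ℤ)) :
    Module.finrank K (S →+ K) = gpRank (S : Set (Fin k → ℤ)) := by
  have : Module.Finite ℤ (AddSubgroup.closure (S : Set (Fin k → ℤ))) :=
    inferInstanceAs (Module.Finite ℤ
      (AddSubgroup.toIntSubmodule (AddSubgroup.closure (S : Set (Fin k → ℤ)))))
  have : Module.Free ℤ (AddSubgroup.closure (S : Set (Fin k → ℤ))) :=
    inferInstanceAs (Module.Free ℤ
      (AddSubgroup.toIntSubmodule (AddSubgroup.closure (S : Set (Fin k → ℤ)))))
  rw [← (LinearEquiv.ofBijective _ (restrictClosure_bijective (K := K) S)).finrank_eq,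
    Module.finrank_linearMap, Module.finrank_self, mul_one]
  rfl

end

/-- The submonoid of the ambient group given by a submonoid of `P`. -/
def toAmbient {k : ℕ} {P : AddSubmonoid (Fin k → ℤ)} (F : AddSubmonoid P) :
    AddSubmonoid (Fin k → ℤ) := F.map P.subtype

/-- `P` is only a monoid, so the extension is made to the ambient group `ℤ^k` and then restricted to
`P`. -/
lemma restrictHom_surjective {k : ℕ} {P : AddSubmonoid (Fin k → ℤ)} (F : AddSubmonoid P) :
    Function.Surjective (restrictHom K F) := by
  intro f
  let e' : toAmbient F →+ F :=
    { toFun := fun x => ⟨⟨x.1, by obtain ⟨y, hy, h⟩ := x.2; rw [← h]; exact y.2⟩, by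
        obtain ⟨y, hy, h⟩ := x.2
        have : y = ⟨x.1, by rw [← h]; exact y.2⟩ := Subtype.ext h
        rw [← this]; exact hy⟩
      map_zero' := rfl
      map_add' := fun _ _ => rfl }
  obtain ⟨G, hG⟩ := exists_extend_of_submonoid (K := K) (toAmbient F) (f.comp e')
  exact ⟨G.comp P.subtype, AddMonoidHom.ext fun x => hG ⟨x.1, x.1, x.2, rfl⟩⟩

/-- Rank-nullity for the surjective restriction from `P` to `F`. This makes the codimension of a
face linear algebra over any field of characteristic zero. -/
lemma finrank_annih {k : ℕ} {P : AddSubmonoid (Fin k → ℤ)} (F : AddSubmonoid P) :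
    Module.finrank K (annih K F) =
      gpRank (P : Set (Fin k → ℤ)) - gpRank (toAmbient F : Set (Fin k → ℤ)) := by
  have := finiteDimensional_hom (K := K) P
  let e : F →+ toAmbient F :=
    { toFun := fun x => ⟨x.1.1, x.1, x.2, rfl⟩, map_zero' := rfl, map_add' := fun _ _ => rfl }
  have hker : LinearMap.ker (restrictHom K F) = annih K F := by
    ext α
    rw [LinearMap.mem_ker, mem_annih]
    exact ⟨fun h a ha => DFunLike.congr_fun h ⟨a, ha⟩, fun h => AddMonoidHom.ext fun x => h x x.2⟩
  let E : F ≃+ toAmbient F := AddEquiv.ofBijective e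
    ⟨fun x y h => Subtype.ext (Subtype.ext (congrArg (fun z : toAmbient F => z.1) h)), by
      rintro ⟨_, y, hy, rfl⟩
      exact ⟨⟨y, hy⟩, rfl⟩⟩
  let E' : (toAmbient F →+ K) ≃ₗ[K] (F →+ K) :=
    { toFun := fun f => f.comp E.toAddMonoidHom
      invFun := fun f => f.comp E.symm.toAddMonoidHom
      map_add' := fun _ _ => rfl
      map_smul' := fun _ _ => rfl
      left_inv := fun f => AddMonoidHom.ext fun x => congrArg f (E.apply_symm_apply x)
      right_inv := fun f => AddMonoidHom.ext fun x => congrArg f (E.symm_apply_apply x) }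
  have h := (restrictHom K F).finrank_range_add_finrank_ker
  rw [hker, LinearMap.range_eq_top.2 (restrictHom_surjective F), finrank_top,
    ← E'.finrank_eq, finrank_hom, finrank_hom] at h
  omega

end

section

/-! ## Morphisms which are positive off a face -/

section

variable {A : Type*} [AddCommMonoid A]

lemma IsFace.add_mem_iff {F : AddSubmonoid A} (hF : IsFace F) {a b : A} :
    a + b ∈ F ↔ a ∈ F ∧ b ∈ F :=
  ⟨hF a b, fun h => F.add_mem h.1 h.2⟩

lemma IsFace.mem_of_nsmul_mem {F : AddSubmonoid A} (hF : IsFace F) {n : ℕ} (hn : n ≠ 0) {a : A}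
    (h : n • a ∈ F) : a ∈ F := by
  obtain ⟨m, rfl⟩ := Nat.exists_eq_succ_of_ne_zero hn
  rw [succ_nsmul] at h
  exact (hF _ _ h).2

lemma isFace_top : IsFace (⊤ : AddSubmonoid A) :=
  fun _ _ _ => ⟨AddSubmonoid.mem_top _, AddSubmonoid.mem_top _⟩

lemma IsFace.comap {B : Type*} [AddCommMonoid B] (φ : B →+ A) {F : AddSubmonoid A}
    (hF : IsFace F) : IsFace (F.comap φ) := fun p q h => by
  rw [AddSubmonoid.mem_comap, map_add] at h
  exact hF _ _ h

/-- `A` is generated by `U` and the finite set `S`. -/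
def GenBy (U : AddSubmonoid A) (S : Finset A) : Prop :=
  U ⊔ AddSubmonoid.closure (S : Set A) = ⊤

lemma GenBy.induction {U : AddSubmonoid A} {S : Finset A} (h : GenBy U S) {C : A → Prop}
    (hU : ∀ u ∈ U, C u) (hS : ∀ s ∈ S, C s) (hadd : ∀ a b, C a → C b → C (a + b)) (a : A) :
    C a := by
  have ha : a ∈ U ⊔ AddSubmonoid.closure (S : Set A) := by
    rw [h]
    exact AddSubmonoid.mem_top a
  obtain ⟨u, hu, s, hs, rfl⟩ := AddSubmonoid.mem_sup.1 ha
  refine hadd _ _ (hU u hu) ?_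
  induction hs using AddSubmonoid.closure_induction with
  | mem x hx => exact hS x hx
  | zero => exact hU 0 U.zero_mem
  | add x y hx hy h1 h2 =>
    exact hadd _ _ (h1 (h ▸ AddSubmonoid.mem_top x)) (h2 (h ▸ AddSubmonoid.mem_top y))

/-- Two faces which contain `U` and the same generators are equal. -/
lemma GenBy.face_eq {U : AddSubmonoid A} {S : Finset A} (h : GenBy U S) {F F' : AddSubmonoid A}
    (hF : IsFace F) (hF' : IsFace F') (hU : U ≤ F) (hU' : U ≤ F')
    (hS : ∀ s ∈ S, s ∈ F ↔ s ∈ F') : F = F' := by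
  ext a
  refine h.induction (C := fun a => a ∈ F ↔ a ∈ F') (fun u hu => ⟨fun _ => hU' hu, fun _ => hU hu⟩)
    hS (fun _ _ ha hb => ?_) a
  rw [hF.add_mem_iff, hF'.add_mem_iff, ha, hb]

/-- The morphism `α` vanishes on `F` and is positive elsewhere. -/
def PosOff {K : Type*} [AddCommMonoid K] [Preorder K] (α : A →+ K) (F : AddSubmonoid A) : Prop :=
  (∀ a ∈ F, α a = 0) ∧ ∀ a, a ∉ F → 0 < α a

lemma PosOff.nonneg {K : Type*} [AddCommMonoid K] [Preorder K] {α : A →+ K} {F : AddSubmonoid A}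
    (h : PosOff α F) (a : A) : 0 ≤ α a := by
  by_cases ha : a ∈ F
  · exact (h.1 a ha).ge
  · exact (h.2 a ha).le

lemma PosOff.comp {B : Type*} [AddCommMonoid B] (φ : B →+ A)
    {K : Type*} [AddCommMonoid K] [Preorder K] {α : A →+ K} {F : AddSubmonoid A}
    (h : PosOff α F) : PosOff (α.comp φ) (F.comap φ) :=
  ⟨fun _ hb => h.1 _ hb, fun _ hb => h.2 _ hb⟩

/-- A sum lying outside `F` has a summand outside `F`, and the other summand contributes a
nonnegative value; hence nonnegativity and positivity are carried through the induction together. -/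
lemma GenBy.posOff {K : Type*} [Field K] [LinearOrder K] [IsStrictOrderedRing K]
    {U : AddSubmonoid A} {S : Finset A} (h : GenBy U S) {F : AddSubmonoid A} (hUF : U ≤ F)
    {α : A →+ K} (hα : ∀ a ∈ F, α a = 0) (hS : ∀ s ∈ S, s ∉ F → 0 < α s) :
    PosOff α F := by
  refine ⟨hα, fun a ha => ?_⟩
  have := h.induction (C := fun a => 0 ≤ α a ∧ (a ∉ F → 0 < α a))
    (fun u hu => ⟨(hα u (hUF hu)).ge, fun h => absurd (hUF hu) h⟩)
    (fun s hs => ⟨?_, hS s hs⟩) (fun a b ha hb => ⟨?_, fun hab => ?_⟩) a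
  · exact this.2 ha
  · by_cases hsF : s ∈ F
    · exact (hα s hsF).ge
    · exact (hS s hs hsF).le
  · rw [map_add]
    exact add_nonneg ha.1 hb.1
  · rw [map_add]
    by_cases haF : a ∈ F
    · have hbF : b ∉ F := fun hb => hab (F.add_mem haF hb)
      exact add_pos_of_nonneg_of_pos ha.1 (hb.2 hbF)
    · exact add_pos_of_pos_of_nonneg (ha.2 haF) hb.1

/-- The zero set of a nonnegative morphism. -/
def zeroFace {K : Type*} [AddCommMonoid K] (α : A →+ K) : AddSubmonoid A := AddMonoidHom.mker α

lemma isFace_zeroFace {K : Type*} [Field K] [LinearOrder K] [IsStrictOrderedRing K]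
    {α : A →+ K} (h : ∀ a, 0 ≤ α a) : IsFace (zeroFace α) := by
  intro p q hpq
  have hpq : α (p + q) = 0 := hpq
  rw [map_add] at hpq
  exact (add_eq_zero_iff_of_nonneg (h p) (h q)).1 hpq

lemma posOff_zeroFace {K : Type*} [Field K] [LinearOrder K] [IsStrictOrderedRing K]
    {α : A →+ K} (h : ∀ a, 0 ≤ α a) : PosOff α (zeroFace α) :=
  ⟨fun _ ha => ha, fun a ha => lt_of_le_of_ne (h a) (Ne.symm ha)⟩

/-- A rational nonnegative morphism has an integral multiple. -/
lemma GenBy.exists_nat_multiple {U : AddSubmonoid A} {S : Finset A} (h : GenBy U S)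
    {α : A →+ ℚ} (hα : ∀ a, 0 ≤ α a) (hU : ∀ u ∈ U, α u = 0) :
    ∃ (n : ℕ) (l : A →+ ℕ), 0 < n ∧ ∀ a, (l a : ℚ) = n * α a := by
  classical
  -- The multiplier is the product of the denominators of the values at the generators.
  have hex : ∀ a, ∃ m : ℕ, (m : ℚ) = (∏ s ∈ S, (α s).den : ℕ) * α a := by
    refine h.induction (fun u hu => ⟨0, by simp [hU u hu]⟩) (fun s hs => ?_) ?_
    · rw [← Finset.prod_erase_mul _ _ hs]
      refine ⟨(∏ s ∈ S.erase s, (α s).den) * (α s).num.toNat, ?_⟩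
      have h1 : ((α s).num.toNat : ℚ) = (α s).den * α s := by
        have h2 : (((α s).num.toNat : ℤ) : ℚ) = (α s).num := by
          rw [Int.toNat_of_nonneg (Rat.num_nonneg.2 (hα s))]
        rw [Rat.den_mul_eq_num, ← h2, Int.cast_natCast]
      rw [Nat.cast_mul, h1, Nat.cast_mul, mul_assoc]
    · rintro a b ⟨m, hm⟩ ⟨m', hm'⟩
      exact ⟨m + m', by rw [map_add, Nat.cast_add, hm, hm', mul_add]⟩
  choose l hl using hex
  refine ⟨_, AddMonoidHom.mk ⟨l, ?_⟩ fun a b => ?_, Finset.prod_pos fun s _ => (α s).den_pos, hl⟩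
  · exact_mod_cast (by rw [hl, map_zero, mul_zero] : (l 0 : ℚ) = 0)
  · have : (l (a + b) : ℚ) = l a + l b := by rw [hl, hl, hl, map_add, mul_add]
    exact_mod_cast this

lemma PosOff.of_multiple {α : A →+ ℚ} {F : AddSubmonoid A} (h : PosOff α F) {n : ℕ} (hn : 0 < n)
    {l : A →+ ℕ} (hl : ∀ a, (l a : ℚ) = n * α a) : PosOff l F := by
  refine ⟨fun a ha => ?_, fun a ha => ?_⟩
  · have := hl a
    rw [h.1 a ha, mul_zero] at this
    exact_mod_cast this
  · have : (0 : ℚ) < l a := by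
      rw [hl]
      exact mul_pos (by exact_mod_cast hn) (h.2 a ha)
    exact_mod_cast this

lemma PosOff.cast {K : Type*} [Field K] [LinearOrder K] [IsStrictOrderedRing K] {l : A →+ ℕ}
    {F : AddSubmonoid A} (h : PosOff l F) : PosOff ((Nat.castAddMonoidHom K).comp l) F :=
  ⟨fun a ha => by rw [AddMonoidHom.comp_apply, h.1 a ha, map_zero],
    fun a ha => Nat.cast_pos.2 (h.2 a ha)⟩

end

/-! ## Existence of positive morphisms -/

/-- Gordan's alternative for abelian groups. -/
lemma exists_pos_hom (n : ℕ) : ∀ {A : Type*} [AddCommGroup A] (v : Fin n → A),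
    (∀ c : Fin n → ℕ, ∑ i, c i • v i = 0 → c = 0) → ∃ f : A →+ ℚ, ∀ i, 0 < f (v i) := by
  induction n with
  | zero => exact fun v _ => ⟨0, fun i => i.elim0⟩
  | succ n ih =>
    intro A _ v hv
    -- Divide out `v 0`. If the other vectors still have no nonnegative relation in the quotient, a
    -- large multiple of the morphism found there, plus some `g` with `g (v 0) = 1`, is positive
    -- everywhere. Such a `g` exists because `v 0` has infinite order.
    by_cases H : ∀ c : Fin n → ℕ,
        ∑ i, c i • (QuotientAddGroup.mk' (AddSubgroup.zmultiples (v 0)) (v i.succ)) = 0 → c = 0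
    · obtain ⟨f, hf⟩ := ih _ H
      have hinj : Function.Injective (zmultiplesHom A (v 0)) := by
        rw [injective_iff_map_eq_zero]
        intro m hm
        have hm : m • v 0 = 0 := hm
        have h1 : m.natAbs • v 0 = 0 := by
          rcases Int.natAbs_eq m with h | h
          · rw [h, natCast_zsmul] at hm
            exact hm
          · rw [h, neg_smul, natCast_zsmul, neg_eq_zero] at hm
            exact hm
        have h2 := hv (Fin.cons m.natAbs 0) (by simp [Fin.sum_univ_succ, h1])
        have h3 := congrFun h2 0
        simpa using h3
      obtain ⟨g, hg⟩ := (Module.Baer.of_divisible ℚ).extension_property_addMonoidHom _ hinj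
        (Int.castAddHom ℚ)
      have hg0 : g (v 0) = 1 := by simpa using DFunLike.congr_fun hg 1
      choose N hN using fun i : Fin n => Archimedean.arch (-g (v i.succ) + 1) (hf i)
      refine ⟨(∑ i, N i) • f.comp (QuotientAddGroup.mk' _) + g, fun i => ?_⟩
      refine Fin.cases ?_ (fun i => ?_) i
      · have : (QuotientAddGroup.mk' (AddSubgroup.zmultiples (v 0))) (v 0) = 0 :=
          (QuotientAddGroup.eq_zero_iff _).2 (AddSubgroup.mem_zmultiples _)
        rw [AddMonoidHom.add_apply, AddMonoidHom.nsmul_apply, AddMonoidHom.comp_apply, this,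
          map_zero, smul_zero, hg0]
        norm_num
      · rw [AddMonoidHom.add_apply, AddMonoidHom.nsmul_apply, AddMonoidHom.comp_apply]
        have h1 := nsmul_le_nsmul_left (hf i).le
          (Finset.single_le_sum (f := N) (fun _ _ => Nat.zero_le _) (Finset.mem_univ i))
        have h2 := hN i
        linarith
    -- Otherwise a nonzero nonnegative combination of the other vectors equals `t • v 0`. Here `t >
    -- 0`, as `t ≤ 0` would give a forbidden relation, so any `f` positive on the other vectors is
    -- also positive on `v 0`.
    · push Not at H
      obtain ⟨c, hc, hc0⟩ := H
      have hmem : ∑ i, c i • v i.succ ∈ AddSubgroup.zmultiples (v 0) := by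
        rw [← QuotientAddGroup.eq_zero_iff, ← hc]
        change QuotientAddGroup.mk' _ _ = _
        simp only [map_sum, map_nsmul]
      obtain ⟨t, ht⟩ := AddSubgroup.mem_zmultiples_iff.1 hmem
      obtain ⟨f, hf⟩ := ih (fun i => v i.succ) fun c hc => by
        have h := hv (Fin.cons 0 c) (by simpa [Fin.sum_univ_succ] using hc)
        funext i
        simpa using congrFun h i.succ
      have ht0 : 0 < t := by
        by_contra h
        push Not at h
        obtain ⟨m, hm⟩ := Int.eq_ofNat_of_zero_le (neg_nonneg.2 h)
        have h' := hv (Fin.cons m c) (by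
          simp only [Fin.sum_univ_succ, Fin.cons_zero, Fin.cons_succ]
          rw [← ht, ← natCast_zsmul, ← hm, neg_smul, neg_add_cancel])
        apply hc0
        funext i
        simpa using congrFun h' i.succ
      have hpos : 0 < ∑ i, c i • f (v i.succ) := by
        obtain ⟨i, hi⟩ := Function.ne_iff.1 hc0
        exact Finset.sum_pos' (fun i _ => nsmul_nonneg (hf i).le _)
          ⟨i, Finset.mem_univ i, nsmul_pos (hf i) hi⟩
      have hft : t • f (v 0) = ∑ i, c i • f (v i.succ) := by
        rw [← map_zsmul, ht, map_sum]
        simp only [map_nsmul]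
      refine ⟨f, fun i => Fin.cases ?_ hf i⟩
      rw [← hft, zsmul_eq_mul] at hpos
      exact pos_of_mul_pos_right hpos (by exact_mod_cast ht0.le)

lemma exists_genBy {k : ℕ} {P : AddSubmonoid (Fin k → ℤ)} (hP : P.FG) :
    ∃ S : Finset P, GenBy ⊥ S := by
  obtain ⟨S, hS⟩ := ((AddMonoid.fg_iff_addSubmonoid_fg P).2 hP).fg_top
  exact ⟨S, by rw [GenBy, hS, bot_sup_eq]⟩

/-- A face of a finitely generated submonoid of `ℤ^k` is the zero set of some morphism to `ℕ`. -/
lemma exists_posOff_nat {k : ℕ} {P : AddSubmonoid (Fin k → ℤ)} (hP : P.FG) {F : AddSubmonoid P}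
    (hF : IsFace F) : ∃ β : P →+ ℕ, PosOff β F := by
  classical
  obtain ⟨S, hS⟩ := exists_genBy hP
  let H := AddSubgroup.closure (toAmbient F : Set (Fin k → ℤ))
  let T := S.filter (· ∉ F)
  let e := T.equivFin.symm
  -- Gordan's alternative is applied in `ℤ^k / F^gp` to the generators outside `F`. A nonnegative
  -- relation there places their combination in `F` after adding an element of `F`, and the face
  -- property then forces all coefficients to vanish.
  obtain ⟨f, hf⟩ := exists_pos_hom T.card
    (fun i => QuotientAddGroup.mk' H ((e i).1 : Fin k → ℤ)) fun c hc => by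
      have h1 : ((∑ i, c i • (e i).1 : P) : Fin k → ℤ) ∈ H := by
        rw [← QuotientAddGroup.eq_zero_iff, ← hc]
        change QuotientAddGroup.mk' _ _ = _
        simp only [AddSubmonoid.coe_finsetSum, AddSubmonoidClass.coe_nsmul, map_sum, map_nsmul]
      obtain ⟨⟨_, a, ha, rfl⟩, ⟨_, b, hb, rfl⟩, hab⟩ := exists_sub_of_mem_closure _ h1
      have h2 : (∑ i, c i • (e i).1) + b = a := Subtype.ext (by
        rw [AddSubmonoid.coe_add, hab]
        simp)
      have h3 : (∑ i, c i • (e i).1) ∈ F := (hF _ b (h2 ▸ ha)).1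
      funext i
      by_contra hi
      rw [← Finset.add_sum_erase _ _ (Finset.mem_univ i)] at h3
      exact (Finset.mem_filter.1 (e i).2).2 (hF.mem_of_nsmul_mem hi (hF _ _ h3).1)
  let α : P →+ ℚ := (f.comp (QuotientAddGroup.mk' H)).comp P.subtype
  have hα : PosOff α F := by
    refine hS.posOff bot_le (fun a ha => ?_) fun s hs hsF => ?_
    · have : QuotientAddGroup.mk' H (a : Fin k → ℤ) = 0 :=
        (QuotientAddGroup.eq_zero_iff _).2 (AddSubgroup.subset_closure ⟨a, ha, rfl⟩)
      change f (QuotientAddGroup.mk' H (a : Fin k → ℤ)) = 0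
      rw [this, map_zero]
    · have := hf (e.symm ⟨s, Finset.mem_filter.2 ⟨hs, hsF⟩⟩)
      rw [e.apply_symm_apply] at this
      exact this
  obtain ⟨n, l, hn, hl⟩ := hS.exists_nat_multiple hα.nonneg
    (fun u hu => by rw [AddSubmonoid.mem_bot.1 hu, map_zero])
  exact ⟨l, hα.of_multiple hn hl⟩

end

section

/-! ## Lifting morphisms positive off a face -/

/-- Only additive monoids are assumed, since scalar multiplication over a field supplies the
negatives. -/
lemma surjective_of_injective_of_finrank_eq {K V W : Type*} [Field K] [AddCommMonoid V]
    [Module K V] [AddCommMonoid W] [Module K W] [Module.Finite K V] [Module.Finite K W]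
    {f : V →ₗ[K] W} (hf : Function.Injective f) (h : Module.finrank K V = Module.finrank K W) :
    Function.Surjective f := by
  let _ : AddCommGroup V := Module.addCommMonoidToAddCommGroup K
  let _ : AddCommGroup W := Module.addCommMonoidToAddCommGroup K
  exact (LinearMap.injective_iff_surjective_of_finrank_eq_finrank h).1 hf

section

variable {A B : Type*} [AddCommMonoid A] [AddCommMonoid B]
  {K : Type*} [Field K] [LinearOrder K] [IsStrictOrderedRing K]

/-- Moving from a morphism positive off `F` in a direction in which it becomes nonpositive at some
generator, one meets a morphism positive off a larger face. -/
lemma GenBy.exists_exit {U : AddSubmonoid A} {S : Finset A} (hS : GenBy U S) {F : AddSubmonoid A}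
    (hUF : U ≤ F) {α β : A →+ K} (hα : PosOff α F) (hβ : ∀ a ∈ F, β a = 0)
    (hs : ∃ s ∈ S, s ∉ F ∧ α s + β s ≤ 0) :
    ∃ τ : K, 0 < τ ∧ τ ≤ 1 ∧ (∀ a, 0 ≤ (α + τ • β) a) ∧
      ∃ s ∈ S, s ∉ F ∧ (α + τ • β) s = 0 := by
  classical
  obtain ⟨s, hsS, hsF, hs⟩ := hs
  have hneg : ∀ s, s ∉ F → α s + β s ≤ 0 → β s < 0 := fun s hsF hs => by
    linarith [hα.2 s hsF]
  -- The exit time is the least `τ` at which `α + τ • β` vanishes on some generator outside `F`; the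
  -- given `s` bounds it by `1`.
  obtain ⟨s₀, hs₀, hmin⟩ := (S.filter fun s => s ∉ F ∧ β s < 0).exists_min_image
    (fun s => α s / -β s) ⟨s, Finset.mem_filter.2 ⟨hsS, hsF, hneg s hsF hs⟩⟩
  obtain ⟨hs₀S, hs₀F, hs₀⟩ := Finset.mem_filter.1 hs₀
  have hle := hmin s (Finset.mem_filter.2 ⟨hsS, hsF, hneg s hsF hs⟩)
  refine ⟨α s₀ / -β s₀, div_pos (hα.2 _ hs₀F) (neg_pos.2 hs₀), hle.trans ?_, ?_, s₀, hs₀S, hs₀F, ?_⟩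
  · rw [div_le_one (neg_pos.2 (hneg s hsF hs))]
    linarith
  · refine hS.induction (fun u hu => ?_) (fun t ht => ?_) fun a b ha hb => ?_
    · rw [AddMonoidHom.add_apply, AddMonoidHom.smul_apply, hα.1 u (hUF hu), hβ u (hUF hu),
        smul_zero, add_zero]
    · rw [AddMonoidHom.add_apply, AddMonoidHom.smul_apply, smul_eq_mul]
      by_cases htF : t ∈ F
      · rw [hα.1 t htF, hβ t htF, mul_zero, add_zero]
      · rcases lt_or_ge (β t) 0 with h | h
        · have h1 := hmin t (Finset.mem_filter.2 ⟨ht, htF, h⟩)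
          rw [le_div_iff₀ (neg_pos.2 h)] at h1
          linarith
        · exact add_nonneg (hα.2 t htF).le
            (mul_nonneg (div_pos (hα.2 _ hs₀F) (neg_pos.2 hs₀)).le h)
    · rw [map_add]
      exact add_nonneg ha hb
  · rw [AddMonoidHom.add_apply, AddMonoidHom.smul_apply, smul_eq_mul]
    field_simp [hs₀.ne]
    ring

/-- Serves to choose perturbations that preserve finitely many strict inequalities, one per
generator. -/
lemma exists_pos_mul_lt {ι : Type*} (T : Finset ι) (a b : ι → K) (ha : ∀ i, 0 ≤ a i) :
    ∃ ε > 0, ∀ i ∈ T, 0 < b i → ε * a i < b i := by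
  classical
  induction T using Finset.induction_on with
  | empty => exact ⟨1, one_pos, by simp⟩
  | insert j T _ ih =>
    obtain ⟨ε, hε, h⟩ := ih
    by_cases hj : 0 < b j
    · have h1 : 0 < a j + 1 := by linarith [ha j]
      -- The `+ 1` keeps the denominator positive when `a j = 0`.
      refine ⟨min ε (b j / (a j + 1)), lt_min hε (div_pos hj h1), fun i hi hb => ?_⟩
      rcases Finset.mem_insert.1 hi with rfl | hi
      · calc _ ≤ b i / (a i + 1) * a i := mul_le_mul_of_nonneg_right (min_le_right _ _) (ha i)
          _ < b i := by
            rw [div_mul_eq_mul_div, div_lt_iff₀ h1]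
            nlinarith
      · exact (mul_le_mul_of_nonneg_right (min_le_left _ _) (ha i)).trans_lt (h i hi hb)
    · refine ⟨ε, hε, fun i hi hb => ?_⟩
      rcases Finset.mem_insert.1 hi with rfl | hi
      · exact absurd hb hj
      · exact h i hi hb

/-- The pullback of morphisms vanishing on a submonoid. -/
def annihComap (φ : B →+ A) (F : AddSubmonoid A) : annih K F →ₗ[K] annih K (F.comap φ) where
  toFun α := ⟨α.1.comp φ, fun _ hb => α.2 _ hb⟩
  map_add' _ _ := rfl
  map_smul' _ _ := rfl

/-- If the pullback by `φ` of any face `F` of `A` has at most the codimension of `F`, then every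
morphism on `B` positive off the pullback of `F` comes from one on `A` positive off `F`. -/
theorem GenBy.exists_posOff_comp_eq (φ : B →+ A) {U : AddSubmonoid A} {S : Finset A} {T : Finset B}
    (hS : GenBy U S) (hT : GenBy (U.comap φ) T) [FiniteDimensional K (annih K U)]
    [FiniteDimensional K (annih K (U.comap φ))]
    (hdim : ∀ F : AddSubmonoid A, U ≤ F → IsFace F →
      Module.finrank K (annih K (F.comap φ)) ≤ Module.finrank K (annih K F))
    {F : AddSubmonoid A} (hUF : U ≤ F) (hF : IsFace F) {α₀ : A →+ K} (hα₀ : PosOff α₀ F)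
    {y : B →+ K} (hy : PosOff y (F.comap φ)) : ∃ α : A →+ K, PosOff α F ∧ α.comp φ = y := by
  classical
  induction hn : (S.filter (· ∉ F)).card using Nat.strong_induction_on generalizing F α₀ y with
  | _ n ih =>
  -- It is enough to find a larger face with the same pullback.
  have larger : ∀ α' : A →+ K, (∀ a, 0 ≤ α' a) → (∀ a ∈ F, α' a = 0) →
      PosOff (α'.comp φ) (F.comap φ) → (∃ s ∈ S, s ∉ F ∧ α' s = 0) →
      ∃ α : A →+ K, PosOff α F ∧ α.comp φ = y := by
    rintro α' h0 hF' hpos ⟨s, hsS, hsF, hs⟩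
    have hle : F ≤ zeroFace α' := hF'
    have hcomap : (zeroFace α').comap φ = F.comap φ := by
      refine le_antisymm (fun b hb => ?_) fun b hb => hle hb
      by_contra hbF
      exact (hpos.2 b hbF).ne' hb
    have hlt : (S.filter (· ∉ zeroFace α')).card < n := by
      rw [← hn]
      refine Finset.card_lt_card ⟨fun t ht => ?_, fun h => ?_⟩
      · rw [Finset.mem_filter] at ht ⊢
        exact ⟨ht.1, fun h => ht.2 (hle h)⟩
      · exact (Finset.mem_filter.1 (h (Finset.mem_filter.2 ⟨hsS, hsF⟩))).2 hs
    have hy0 := hα₀.comp φ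
    -- The larger face yields lifts vanishing on too much. Hence a small multiple of `α₀.comp φ` is
    -- first split off from `y`: the induction lifts `(1 + ε) • y - ε • α₀.comp φ`, and adding `ε •
    -- α₀` to that lift restores positivity off `F`.
    obtain ⟨ε, hε, hεT⟩ := exists_pos_mul_lt T (fun b => (α₀.comp φ) b) (fun b => y b) hy0.nonneg
    have hy' : PosOff ((1 + ε) • y - ε • α₀.comp φ) (F.comap φ) := by
      refine hT.posOff (fun b hb => hUF hb) (fun b hb => ?_) fun t ht htF => ?_
      · rw [AddMonoidHom.sub_apply, AddMonoidHom.smul_apply, AddMonoidHom.smul_apply, hy.1 b hb,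
          hy0.1 b hb, smul_zero, smul_zero, sub_zero]
      · have h1 := hεT t ht (hy.2 t htF)
        have h2 := mul_pos hε (hy.2 t htF)
        rw [AddMonoidHom.sub_apply, AddMonoidHom.smul_apply, AddMonoidHom.smul_apply,
          smul_eq_mul, smul_eq_mul]
        linarith
    rw [← hcomap] at hy'
    obtain ⟨α'', hα'', hφ⟩ := ih _ hlt (hUF.trans hle) (isFace_zeroFace h0) (posOff_zeroFace h0)
      hy' rfl
    have h1ε : 0 < 1 + ε := by linarith
    refine ⟨(1 + ε)⁻¹ • (α'' + ε • α₀), ⟨fun a ha => ?_, fun a ha => ?_⟩, ?_⟩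
    · rw [AddMonoidHom.smul_apply, AddMonoidHom.add_apply, AddMonoidHom.smul_apply,
        hα''.1 a (hle ha), hα₀.1 a ha, smul_zero, add_zero, smul_zero]
    · rw [AddMonoidHom.smul_apply, AddMonoidHom.add_apply, AddMonoidHom.smul_apply]
      exact mul_pos (inv_pos.2 h1ε) (add_pos_of_nonneg_of_pos (hα''.nonneg a)
        (mul_pos hε (hα₀.2 a ha)))
    · ext b
      have h2 := DFunLike.congr_fun hφ b
      rw [AddMonoidHom.sub_apply, AddMonoidHom.smul_apply, AddMonoidHom.smul_apply,
        smul_eq_mul, smul_eq_mul, AddMonoidHom.comp_apply, AddMonoidHom.comp_apply] at h2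
      rw [AddMonoidHom.comp_apply, AddMonoidHom.smul_apply, AddMonoidHom.add_apply,
        AddMonoidHom.smul_apply, h2, smul_eq_mul, smul_eq_mul]
      field_simp
      ring
  -- As long as the pullback stays positive off `F.comap φ` along the segment, the point of exit
  -- lies on a larger face with the same pullback.
  have exit : ∀ β : A →+ K, (∀ a ∈ F, β a = 0) → (∃ s ∈ S, s ∉ F ∧ α₀ s + β s ≤ 0) →
      (∀ τ : K, 0 < τ → τ ≤ 1 → PosOff ((α₀ + τ • β).comp φ) (F.comap φ)) →
      ∃ α : A →+ K, PosOff α F ∧ α.comp φ = y := by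
    intro β hβ hs hφ
    obtain ⟨τ, hτ, hτ1, h0, h⟩ := hS.exists_exit hUF hα₀ hβ hs
    refine larger _ h0 (fun a ha => ?_) (hφ τ hτ hτ1) h
    rw [AddMonoidHom.add_apply, AddMonoidHom.smul_apply, hα₀.1 a ha, hβ a ha, smul_zero, add_zero]
  have : FiniteDimensional K (annih K F) :=
    Submodule.finiteDimensional_of_le (annih_anti hUF)
  have : FiniteDimensional K (annih K (F.comap φ)) :=
    Submodule.finiteDimensional_of_le (annih_anti (F := U.comap φ) fun b hb => hUF hb)
  -- If pullback is injective on morphisms vanishing on `F`, the dimension bound makes it bijective,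
  -- so `y - α₀.comp φ` has a preimage `β`. Either `α₀ + β` is the lift, or the segment towards it
  -- exits; its pullback `(1 - τ) • α₀.comp φ + τ • y` stays positive meanwhile.
  by_cases hinj : Function.Injective (annihComap (K := K) φ F)
  · have heq : Module.finrank K (annih K F) = Module.finrank K (annih K (F.comap φ)) :=
      le_antisymm (LinearMap.finrank_le_finrank_of_injective hinj) (hdim F hUF hF)
    have hsurj := surjective_of_injective_of_finrank_eq hinj heq
    have hy0 := hα₀.comp φ
    obtain ⟨⟨β, hβ⟩, hβy⟩ := hsurj ⟨y - α₀.comp φ, fun b hb => by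
      rw [AddMonoidHom.sub_apply, hy.1 b hb, hy0.1 b hb, sub_zero]⟩
    have hβy : ∀ b, β (φ b) = y b - α₀ (φ b) := fun b =>
      DFunLike.congr_fun (congrArg Subtype.val hβy) b
    by_cases hs : ∃ s ∈ S, s ∉ F ∧ α₀ s + β s ≤ 0
    · refine exit β hβ hs fun τ hτ hτ1 => ⟨fun b hb => ?_, fun b hb => ?_⟩
      · change α₀ (φ b) + τ * β (φ b) = 0
        rw [hα₀.1 _ hb, hβ _ hb, mul_zero, add_zero]
      · change 0 < α₀ (φ b) + τ * β (φ b)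
        rw [hβy]
        have h1 : 0 < τ * y b := mul_pos hτ (hy.2 b hb)
        have h2 : 0 ≤ (1 - τ) * α₀ (φ b) := mul_nonneg (sub_nonneg.2 hτ1) (hα₀.nonneg _)
        linarith
    · push Not at hs
      refine ⟨α₀ + β, hS.posOff hUF (fun a ha => ?_) fun s hsS hsF => hs s hsS hsF, ?_⟩
      · rw [AddMonoidHom.add_apply, hα₀.1 a ha, hβ a ha, add_zero]
      · ext b
        change α₀ (φ b) + β (φ b) = y b
        rw [hβy]
        ring
  -- Otherwise move along a nonzero `β` killed by pullback, which leaves the pullback of `α₀`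
  -- unchanged. It is scaled so that the sum with `α₀` vanishes at a generator where `β` is nonzero.
  · rw [injective_iff_map_eq_zero] at hinj
    push Not at hinj
    obtain ⟨⟨β, hβ⟩, hβφ, hβ0⟩ := hinj
    have hβφ : ∀ b, β (φ b) = 0 := fun b => DFunLike.congr_fun (congrArg Subtype.val hβφ) b
    obtain ⟨s, hsS, hsF, hs⟩ : ∃ s ∈ S, s ∉ F ∧ β s ≠ 0 := by
      by_contra! h
      refine hβ0 (Subtype.ext (AddMonoidHom.ext fun a => ?_))
      refine hS.induction (C := fun a => β a = 0) (fun u hu => hβ u (hUF hu)) (fun s hs => ?_)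
        (fun a b ha hb => by rw [map_add, ha, hb, add_zero]) a
      by_cases hsF : s ∈ F
      · exact hβ s hsF
      · exact h s hs hsF
    refine exit ((-(α₀ s / β s)) • β) (fun a ha => ?_) ⟨s, hsS, hsF, ?_⟩ fun τ _ _ => ?_
    · rw [AddMonoidHom.smul_apply, hβ a ha, smul_zero]
    · rw [AddMonoidHom.smul_apply, smul_eq_mul, neg_mul, div_mul_cancel₀ _ hs, add_neg_cancel]
    · have : (α₀ + τ • (-(α₀ s / β s)) • β).comp φ = α₀.comp φ := by
        ext b
        change α₀ (φ b) + τ * (-(α₀ s / β s) * β (φ b)) = α₀ (φ b)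
        rw [hβφ, mul_zero, mul_zero, add_zero]
      rw [this]
      exact hα₀.comp φ

/-- Under the same conditions, the pullback of morphisms vanishing on `F` is surjective. -/
theorem GenBy.annihComap_surjective (φ : B →+ A) {U : AddSubmonoid A} {S : Finset A} {T : Finset B}
    (hS : GenBy U S) (hT : GenBy (U.comap φ) T) [FiniteDimensional K (annih K U)]
    [FiniteDimensional K (annih K (U.comap φ))]
    (hdim : ∀ F : AddSubmonoid A, U ≤ F → IsFace F →
      Module.finrank K (annih K (F.comap φ)) ≤ Module.finrank K (annih K F))
    (hU : IsFace U) {α₀ : A →+ K} (hα₀ : PosOff α₀ U) :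
    Function.Surjective (annihComap (K := K) φ U) := by
  rintro ⟨y, hy⟩
  have hy0 := hα₀.comp φ
  -- Adding a small multiple of an arbitrary `y` to the interior point `α₀.comp φ` stays in the
  -- interior; lift the result, subtract `α₀` and rescale.
  obtain ⟨ε, hε, hεT⟩ := exists_pos_mul_lt T (fun b => |y b|) (fun b => α₀ (φ b))
    fun b => abs_nonneg _
  have hy' : PosOff (ε • y + α₀.comp φ) (U.comap φ) := by
    refine hT.posOff le_rfl (fun b hb => ?_) fun t ht htU => ?_
    · rw [AddMonoidHom.add_apply, AddMonoidHom.smul_apply, hy b hb, hy0.1 b hb, smul_zero, add_zero]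
    · have h1 := hεT t ht (hy0.2 t htU)
      have h2 := mul_le_mul_of_nonneg_left (neg_le_abs (y t)) hε.le
      change 0 < ε * y t + α₀ (φ t)
      linarith
  obtain ⟨α, hα, hαy⟩ := hS.exists_posOff_comp_eq φ hT hdim le_rfl hU hα₀ hy'
  refine ⟨⟨ε⁻¹ • (α - α₀), fun a ha => ?_⟩, Subtype.ext (AddMonoidHom.ext fun b => ?_)⟩
  · rw [AddMonoidHom.smul_apply, AddMonoidHom.sub_apply, hα.1 a ha, hα₀.1 a ha, sub_zero, smul_zero]
  · have h1 : α (φ b) = ε * y b + α₀ (φ b) := DFunLike.congr_fun hαy b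
    change ε⁻¹ * (α (φ b) - α₀ (φ b)) = y b
    rw [h1, add_sub_cancel_right, inv_mul_cancel_left₀ hε.ne']

/-- An interior element of the monoid of morphisms to `ℕ` dominates every element. -/
lemma GenBy.exists_add_eq_nsmul {U : AddSubmonoid A} {S : Finset A} (hS : GenBy U S)
    {l : A →+ ℕ} (hl : PosOff l U) {a : A →+ ℕ} (ha : ∀ u ∈ U, a u = 0) :
    ∃ n : ℕ, ∀ m ≥ n, ∃ a' : A →+ ℕ, (∀ u ∈ U, a' u = 0) ∧ a + a' = m • l := by
  -- At generators outside `U` the integer `l s` is at least `1`, so this sum bounds `a s` by a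
  -- multiple of `l s`.
  refine ⟨∑ s ∈ S, a s, fun m hm => ?_⟩
  have hle : ∀ b, a b ≤ m * l b := by
    refine hS.induction (fun u hu => by rw [ha u hu]; exact Nat.zero_le _) (fun s hs => ?_) ?_
    · by_cases hsU : s ∈ U
      · rw [ha s hsU]
        exact Nat.zero_le _
      · calc a s ≤ ∑ s ∈ S, a s := Finset.single_le_sum (f := fun s => a s)
              (fun _ _ => Nat.zero_le _) hs
          _ ≤ m := hm
          _ ≤ m * l s := Nat.le_mul_of_pos_right _ (hl.2 s hsU)
    · intro b c hb hc
      rw [map_add, map_add, mul_add]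
      exact add_le_add hb hc
  -- By `hle` the truncated subtraction is a true one, and hence additive.
  refine ⟨⟨⟨fun b => m * l b - a b, by simp⟩, fun b c => ?_⟩, fun u hu => ?_, ?_⟩
  · have h1 := hle b
    have h2 := hle c
    simp only [map_add, mul_add]
    omega
  · change m * l u - a u = 0
    rw [hl.1 u hu, mul_zero, Nat.zero_sub]
  · ext b
    change a b + (m * l b - a b) = m • l b
    rw [smul_eq_mul, Nat.add_sub_cancel' (hle b)]

end

end

section

namespace Model

variable {k : ℕ} {P : AddSubmonoid (Fin k → ℤ)}

/-! ## Supports of points of model spaces -/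

/-- The support of a point as a submonoid of `P`. -/
def suppSub (u : Model P) : AddSubmonoid P where
  carrier := {p | lam p u ≠ 0}
  zero_mem' := by
    change lam 0 u ≠ 0
    rw [lam_zero]
    exact one_ne_zero
  add_mem' {p q} hp hq := by
    change lam (p + q) u ≠ 0
    rw [lam_add]
    exact mul_ne_zero hp hq

lemma mem_suppSub {u : Model P} {p : P} : p ∈ suppSub u ↔ lam p u ≠ 0 := Iff.rfl

lemma lam_pos_of_mem {u : Model P} {p : P} (h : p ∈ suppSub u) : 0 < lam p u :=
  lt_of_le_of_ne (lam_nonneg p u) (Ne.symm h)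

lemma isFace_suppSub (u : Model P) : IsFace (suppSub u) := fun p q h => by
  rw [mem_suppSub, lam_add] at h
  exact ⟨left_ne_zero_of_mul h, right_ne_zero_of_mul h⟩

lemma supp_eq (u : Model P) : supp u = (toAmbient (suppSub u) : Set (Fin k → ℤ)) := by
  ext a
  constructor
  · rintro ⟨h, h'⟩
    exact ⟨⟨a, h⟩, h', rfl⟩
  · rintro ⟨p, hp, rfl⟩
    exact ⟨p.2, hp⟩

lemma depth_eq_finrank (K : Type*) [Field K] [CharZero K] (u : Model P) :
    depth u = Module.finrank K (annih K (suppSub u)) := by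
  rw [finrank_annih, depth, supp_eq]

/-- Nonvanishing of `λ_p` is an open condition. It need only be imposed on the finitely many
generators, because the support is a face. -/
lemma eventually_suppSub_le (hP : P.FG) (u : Model P) :
    ∀ᶠ u' in 𝓝 u, suppSub u ≤ suppSub u' := by
  obtain ⟨S, hS⟩ := exists_genBy hP
  have h : ∀ᶠ u' in 𝓝 u, ∀ s ∈ S, s ∈ suppSub u → s ∈ suppSub u' := by
    rw [Filter.eventually_all_finset]
    intro s _
    by_cases hs : s ∈ suppSub u
    · filter_upwards [(continuous_lam s).continuousAt.eventually_ne hs] with u' hu' _ using hu'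
    · exact Eventually.of_forall fun _ h => absurd h hs
  filter_upwards [h] with u' hu' p
  refine hS.induction (C := fun p => p ∈ suppSub u → p ∈ suppSub u') (fun p hp _ => ?_) hu'
    (fun p q hp hq hpq => ?_) p
  · rw [AddSubmonoid.mem_bot.1 hp]
    exact AddSubmonoid.zero_mem _
  · rw [(isFace_suppSub u).add_mem_iff] at hpq
    exact AddSubmonoid.add_mem _ (hp hpq.1) (hq hpq.2)

/-- Two nested supports of the same codimension are equal. -/
lemma suppSub_eq_of_le (hP : P.FG) {u u' : Model P} (hle : suppSub u ≤ suppSub u')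
    (h : depth u = depth u') : suppSub u = suppSub u' := by
  refine le_antisymm hle fun p hp => ?_
  by_contra hpu
  -- `β` vanishes exactly on the smaller support, whereas equality of dimensions makes it vanish on
  -- the larger one too.
  obtain ⟨β, hβ⟩ := exists_posOff_nat hP (isFace_suppSub u)
  have := finiteDimensional_hom (K := ℚ) P
  rw [depth_eq_finrank ℚ, depth_eq_finrank ℚ] at h
  obtain ⟨γ, hγ⟩ := surjective_of_injective_of_finrank_eq
    (Submodule.inclusion_injective (annih_anti (K := ℚ) hle)) h.symm
    ⟨(Nat.castAddMonoidHom ℚ).comp β, fun a ha => by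
      rw [AddMonoidHom.comp_apply, hβ.1 a ha, map_zero]⟩
  have h1 : γ.1 p = (β p : ℚ) := DFunLike.congr_fun (congrArg Subtype.val hγ) p
  rw [γ.2 p hp] at h1
  have h2 := hβ.2 p hpu
  have h3 : β p = 0 := by exact_mod_cast h1.symm
  exact h2.ne' h3

/-! ## Curves in model spaces -/

lemma tendsto_nhds_iff {ι : Type*} {l : Filter ι} {v : ι → Model P} {u : Model P} :
    Tendsto v l (𝓝 u) ↔ ∀ p, Tendsto (fun i => lam p (v i)) l (𝓝 (lam p u)) := by
  rw [nhds_induced, tendsto_comap_iff, tendsto_pi_nhds]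
  rfl

lemma continuous_iff_lam {T : Type*} [TopologicalSpace T] {v : T → Model P} :
    Continuous v ↔ ∀ p, Continuous fun t => lam p (v t) := by
  rw [continuous_induced_rng, continuous_pi_iff]
  rfl

open Classical in
/-- The curve `s ↦ exp(L - sβ)` in the stratum of `X_P` given by the face `F`. -/
def curve (F : AddSubmonoid P) (hF : IsFace F) (L : P →+ ℝ) (β : P →+ ℕ) (s : ℝ) : Model P :=
  show Multiplicative P →* ℝ≥0 from
  { toFun := fun p => if p.toAdd ∈ F then (Real.exp (L p.toAdd - s * β p.toAdd)).toNNReal else 0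
    map_one' := by
      rw [toAdd_one, if_pos F.zero_mem]
      simp
    map_mul' := fun p q => by
      rw [toAdd_mul]
      by_cases h : p.toAdd ∈ F ∧ q.toAdd ∈ F
      · rw [if_pos (F.add_mem h.1 h.2), if_pos h.1, if_pos h.2,
          ← Real.toNNReal_mul (Real.exp_pos _).le, ← Real.exp_add, map_add, map_add]
        congr 2
        push_cast
        ring
      · rw [if_neg fun h' => h (hF _ _ h')]
        rw [not_and_or] at h
        rcases h with h | h
        · rw [if_neg h, zero_mul]
        · rw [if_neg h, mul_zero] }

lemma lam_curve_of_mem {F : AddSubmonoid P} (hF : IsFace F) (L : P →+ ℝ) (β : P →+ ℕ) (s : ℝ)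
    {p : P} (hp : p ∈ F) : lam p (curve F hF L β s) = Real.exp (L p - s * β p) :=
  (congrArg NNReal.toReal (if_pos hp)).trans (Real.coe_toNNReal _ (Real.exp_pos _).le)

lemma lam_curve_of_notMem {F : AddSubmonoid P} (hF : IsFace F) (L : P →+ ℝ) (β : P →+ ℕ) (s : ℝ)
    {p : P} (hp : p ∉ F) : lam p (curve F hF L β s) = 0 :=
  congrArg NNReal.toReal (if_neg hp)

lemma suppSub_curve {F : AddSubmonoid P} (hF : IsFace F) (L : P →+ ℝ) (β : P →+ ℕ) (s : ℝ) :
    suppSub (curve F hF L β s) = F := by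
  ext p
  rw [mem_suppSub]
  by_cases hp : p ∈ F
  · rw [lam_curve_of_mem hF L β s hp]
    exact iff_of_true (Real.exp_pos _).ne' hp
  · rw [lam_curve_of_notMem hF L β s hp]
    exact iff_of_false (fun h => h rfl) hp

lemma continuous_curve {F : AddSubmonoid P} (hF : IsFace F) (L : P →+ ℝ) (β : P →+ ℕ) :
    Continuous (curve F hF L β) := by
  rw [continuous_iff_lam]
  intro p
  by_cases hp : p ∈ F
  · simp only [lam_curve_of_mem hF L β _ hp]
    fun_prop
  · simp only [lam_curve_of_notMem hF L β _ hp]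
    exact continuous_const

/-- Along the curve `λ_p` is constant for `p` in the support of `u`, decays exponentially on the
rest of `F` where `β` is positive, and is zero off `F`. Thus every face above the support gives a
stratum adherent to `u`. -/
lemma tendsto_curve {u : Model P} {F : AddSubmonoid P} (hF : IsFace F) (huF : suppSub u ≤ F)
    {L : P →+ ℝ} (hL : ∀ p ∈ suppSub u, lam p u = Real.exp (L p)) {β : P →+ ℕ}
    (hβ : PosOff β (suppSub u)) : Tendsto (curve F hF L β) atTop (𝓝 u) := by
  rw [tendsto_nhds_iff]
  intro p
  by_cases hpF : p ∈ F
  · simp only [lam_curve_of_mem hF L β _ hpF]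
    by_cases hp : p ∈ suppSub u
    · rw [hL p hp, hβ.1 p hp]
      simp only [Nat.cast_zero, mul_zero, sub_zero]
      exact tendsto_const_nhds
    · have h0 : lam p u = 0 := not_not.1 hp
      rw [h0]
      refine Real.tendsto_exp_atBot.comp ?_
      have h1 : Tendsto (fun s : ℝ => s * (β p : ℝ)) atTop atTop :=
        tendsto_id.atTop_mul_const (by exact_mod_cast hβ.2 p hp)
      simp only [sub_eq_add_neg]
      exact tendsto_atBot_add_const_left _ _ (tendsto_neg_atTop_atBot.comp h1)
  · simp only [lam_curve_of_notMem hF L β _ hpF]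
    have h0 : lam p u = 0 := by
      by_contra h
      exact hpF (huF h)
    rw [h0]
    exact tendsto_const_nhds

/-- The logarithm of `λ_p(u)` is additive on the support and extends to `P`, although no extension
is canonical. -/
lemma exists_log (u : Model P) : ∃ L : P →+ ℝ, ∀ p ∈ suppSub u, lam p u = Real.exp (L p) := by
  obtain ⟨L, hL⟩ := restrictHom_surjective (K := ℝ) (suppSub u)
    { toFun := fun p => Real.log (lam p.1 u)
      map_zero' := by
        rw [AddSubmonoid.coe_zero, lam_zero, Real.log_one]
      map_add' := fun p q => by
        rw [AddSubmonoid.coe_add, lam_add, Real.log_mul p.2 q.2] }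
  refine ⟨L, fun p hp => ?_⟩
  have h : L p = Real.log (lam p u) := DFunLike.congr_fun hL ⟨p, hp⟩
  rw [h, Real.exp_log (lam_pos_of_mem hp)]

lemma curve_mem_interior (L : P →+ ℝ) (β : P →+ ℕ) (s : ℝ) :
    curve ⊤ isFace_top L β s ∈ interior P := fun p => by
  rw [lam_curve_of_mem _ _ _ _ (AddSubmonoid.mem_top p)]
  exact Real.exp_pos _

/-- The interior of `X_P` is dense. -/
lemma exists_mem_interior (hP : P.FG) {u : Model P} {V : Set (Model P)} (hV : V ∈ 𝓝 u) :
    ∃ v ∈ V, v ∈ interior P := by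
  obtain ⟨L, hL⟩ := exists_log u
  obtain ⟨β, hβ⟩ := exists_posOff_nat hP (isFace_suppSub u)
  obtain ⟨s, hs⟩ := ((tendsto_curve isFace_top le_top hL hβ).eventually hV).exists
  exact ⟨_, hs, curve_mem_interior L β s⟩

lemma SmoothRealAt.continuousAt {f : Model P → ℝ} {u : Model P} (h : SmoothRealAt f u) :
    ContinuousAt f u := by
  obtain ⟨U, hU, hu, n, r, W, g, hW, hg, H⟩ := h
  have hc : ContinuousAt (fun x => g fun i => lam (r i) x) u :=
    ContinuousAt.comp (f := fun x => fun i => lam (r i) x) (g := g)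
      (hg.continuousOn.continuousAt (hW.mem_nhds (H u hu).1))
      (continuous_pi fun i => continuous_lam (r i)).continuousAt
  refine hc.congr ?_
  filter_upwards [hU.mem_nhds hu] with x hx using (H x hx).2.symm

/-- If `λ_p · h = λ_q · h'` near `u` with `h, h'` continuous and positive at `u`, then `p` and `q`
have the same image under every morphism vanishing on the support of `u`. -/
lemma eq_of_lam_mul_eq (hP : P.FG) {u : Model P} {p q : P} {h h' : Model P → ℝ}
    (hh : ContinuousAt h u) (hh' : ContinuousAt h' u) (h0 : 0 < h u) (h0' : 0 < h' u)
    (H : ∀ᶠ x in 𝓝 u, lam p x * h x = lam q x * h' x) {α : P →+ ℝ}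
    (hα : ∀ a ∈ suppSub u, α a = 0) : α p = α q := by
  obtain ⟨β, hβ⟩ := exists_posOff_nat hP (isFace_suppSub u)
  -- Take logarithms of the identity along an interior curve tending to `u`: an affine function of
  -- `s` has a finite limit, so its slope is zero and its constant term depends only on `h` and
  -- `h'`.
  have key : ∀ L : P →+ ℝ, (∀ p ∈ suppSub u, lam p u = Real.exp (L p)) →
      L p - L q = Real.log (h' u) - Real.log (h u) := by
    intro L hL
    have ht := tendsto_curve isFace_top le_top hL hβ
    have hlim : Tendsto (fun s => Real.log (h' (curve ⊤ isFace_top L β s)) -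
        Real.log (h (curve ⊤ isFace_top L β s))) atTop
        (𝓝 (Real.log (h' u) - Real.log (h u))) :=
      (((Real.continuousAt_log h0'.ne').tendsto.comp (hh'.tendsto.comp ht)).sub
        ((Real.continuousAt_log h0.ne').tendsto.comp (hh.tendsto.comp ht)))
    have hev : (fun s => Real.log (h' (curve ⊤ isFace_top L β s)) -
        Real.log (h (curve ⊤ isFace_top L β s))) =ᶠ[atTop]
        fun s => (L p - L q) + s * ((β q : ℝ) - β p) := by
      filter_upwards [ht.eventually H, ht.eventually (hh.eventually (lt_mem_nhds h0)),
        ht.eventually (hh'.eventually (lt_mem_nhds h0'))] with s hs h1 h2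
      rw [lam_curve_of_mem _ _ _ _ (AddSubmonoid.mem_top _),
        lam_curve_of_mem _ _ _ _ (AddSubmonoid.mem_top _)] at hs
      have := congrArg Real.log hs
      rw [Real.log_mul (Real.exp_pos _).ne' h1.ne', Real.log_mul (Real.exp_pos _).ne' h2.ne',
        Real.log_exp, Real.log_exp] at this
      linear_combination -this
    have hlin := hlim.congr' hev
    have hzero : (β q : ℝ) - β p = 0 := by
      have h1 := (hlin.sub_const (L p - L q)).mul (tendsto_inv_atTop_zero (𝕜 := ℝ))
      rw [mul_zero] at h1
      refine tendsto_nhds_unique (Tendsto.congr' ?_ tendsto_const_nhds) h1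
      filter_upwards [eventually_ne_atTop 0] with s hs
      field_simp
      ring
    rw [hzero] at hlin
    simp only [mul_zero, add_zero] at hlin
    exact tendsto_nhds_unique tendsto_const_nhds hlin
  obtain ⟨L, hL⟩ := exists_log u
  have h1 := key L hL
  -- Both `L` and `L + α` are logarithms of `u`; comparing them isolates `α`.
  have h2 := key (L + α) fun p hp => by
    rw [AddMonoidHom.add_apply, hα p hp, add_zero, hL p hp]
  rw [AddMonoidHom.add_apply, AddMonoidHom.add_apply] at h2
  linarith

end Model

end

section

universe u

variable {X : Type u} [TopologicalSpace X]

/-! ## Changes of charts -/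

lemma eventually_symm_chart {c : GChart X} {x : X} (hx : x ∈ c.φ.target) :
    ∀ᶠ t in 𝓝 (c.φ.symm x), c.φ.symm (c.φ t) = t :=
  c.φ.eventually_left_inverse' hx

lemma localRep_id_mem {c d : GChart X} {t : Model c.P} (ht : t ∈ localDom id c d) :
    localRep id c d t ∈ localDom id d c :=
  ⟨d.φ.map_target ht.2, by
    change d.φ (localRep id c d t) ∈ c.φ.target
    rw [chart_localRep ht]
    exact c.φ.map_source ht.1⟩

lemma localRep_id_localRep_id {c d : GChart X} {t : Model c.P} (ht : t ∈ localDom id c d) :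
    localRep id d c (localRep id c d t) = t := by
  change c.φ.symm (d.φ (localRep id c d t)) = t
  rw [chart_localRep ht]
  exact c.φ.left_inv ht.1

variable [ManifoldGC X]

/-- Changes of charts preserve interiors. -/
lemma localRep_id_mem_interior {c d : GChart X} (hc : c ∈ ManifoldGC.atlas)
    (hd : d ∈ ManifoldGC.atlas) {t : Model c.P} (ht : t ∈ localDom id c d)
    (hi : t ∈ Model.interior c.P) : localRep id c d t ∈ Model.interior d.P := by
  intro q
  refine lt_of_le_of_ne (Model.lam_nonneg _ _) fun h0 => ?_
  have hcd := ManifoldGC.compatible c hc d hd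
  obtain ⟨U, hU, htU, ⟨p, h, -, H⟩ | H⟩ := hcd.1.2 q t ht
  · have h1 : 0 < h t ∧ Model.lam q (localRep id c d t) = Model.lam p t * h t := H t htU
    rw [← h0] at h1
    exact (mul_pos (hi p) h1.1).ne h1.2
  -- If `λ_q` vanished identically after the change of charts, it would vanish near the image of
  -- `t`, where the interior is dense.
  · have ho := isOpen_localDom continuous_id d c
    have hm := localRep_id_mem ht
    have hcont : ContinuousAt (localRep id d c) (localRep id c d t) :=
      hcd.2.1.continuousAt (ho.mem_nhds hm)
    have hev : ∀ᶠ s in 𝓝 (localRep id c d t), localRep id d c s ∈ U :=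
      hcont.eventually (by rw [localRep_id_localRep_id ht]; exact hU.mem_nhds htU)
    obtain ⟨s, ⟨hsU, hs⟩, hsi⟩ := Model.exists_mem_interior d.weaklyToric.fg
      (hev.and (ho.mem_nhds hm))
    have h1 : Model.lam q (localRep id c d (localRep id d c s)) = 0 := H _ hsU
    rw [localRep_id_localRep_id hs] at h1
    exact (hsi q).ne' h1

/-- Interior functions can be recognized in a single chart. -/
lemma interiorFunAt_of_chart {c : GChart X} (hc : c ∈ ManifoldGC.atlas) {x : X}
    (hx : x ∈ c.φ.target) {b : X → ℝ}
    (h : Model.SmoothNonnegAt (fun t => b (c.φ t)) (c.φ.symm x))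
    (h' : ∀ᶠ t in 𝓝 (c.φ.symm x), t ∈ Model.interior c.P → 0 < b (c.φ t)) :
    InteriorFunAt b x := by
  intro d hd hxd
  have hm : d.φ.symm x ∈ localDom id d c := mem_localDom hxd hx
  have ho := isOpen_localDom continuous_id d c
  have hs := (ManifoldGC.compatible d hd c hc).1
  have he : localRep id d c (d.φ.symm x) = c.φ.symm x := localRep_symm (f := id) hxd
  rw [← he] at h h'
  refine ⟨(h.pullback ho hs hm).congr ?_, ?_⟩
  · filter_upwards [ho.mem_nhds hm] with t ht
    rw [chart_localRep ht]
    rfl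
  · filter_upwards [ho.mem_nhds hm, (hs.1.continuousAt (ho.mem_nhds hm)).eventually h']
      with t ht ht' hi
    have := ht' (localRep_id_mem_interior hd hc ht hi)
    rwa [chart_localRep ht] at this

lemma InteriorFunAt.nonneg {b : X → ℝ} {x : X} (h : InteriorFunAt b x) : 0 ≤ b x := by
  obtain ⟨c, hc, hx⟩ := ManifoldGC.covers x
  obtain ⟨U, -, hu, ⟨p, h, -, H⟩ | H⟩ := (h c hc hx).1
  · have h1 : 0 < h (c.φ.symm x) ∧
        b (c.φ (c.φ.symm x)) = Model.lam p (c.φ.symm x) * h (c.φ.symm x) := H _ hu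
    rw [c.φ.right_inv hx] at h1
    rw [h1.2]
    exact mul_nonneg (Model.lam_nonneg _ _) h1.1.le
  · have h1 : b (c.φ (c.φ.symm x)) = 0 := H _ hu
    rw [c.φ.right_inv hx] at h1
    exact h1.ge

lemma InteriorFunAt.continuousAt {b : X → ℝ} {x : X} (h : InteriorFunAt b x) {c : GChart X}
    (hc : c ∈ ManifoldGC.atlas) (hx : x ∈ c.φ.target) :
    ContinuousAt (fun t => b (c.φ t)) (c.φ.symm x) :=
  (h c hc hx).1.smoothRealAt.continuousAt

/-! ## Interior germs in charts -/

/-- The interior germs which are positive. -/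
def unitSub (x : X) : AddSubmonoid (Additive (interiorGerms x)) where
  carrier := {b | 0 < b.toMul.1.value}
  zero_mem' := zero_lt_one (α := ℝ)
  add_mem' := by
    rintro ⟨_, a, rfl, ha⟩ ⟨_, b, rfl, hb⟩ h h'
    exact mul_pos (show 0 < a x from h) (show 0 < b x from h')

lemma isFace_unitSub (x : X) : IsFace (unitSub x) := by
  rintro ⟨_, a, rfl, ha⟩ ⟨_, b, rfl, hb⟩ h
  have h : 0 < a x * b x := h
  exact ⟨lt_of_le_of_ne ha.nonneg (left_ne_zero_of_mul h.ne').symm,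
    lt_of_le_of_ne hb.nonneg (right_ne_zero_of_mul h.ne').symm⟩

section Chart

variable {c : GChart X} (hc : c ∈ ManifoldGC.atlas) {x : X} (hx : x ∈ c.φ.target)

include hc hx in
lemma interiorFunAt_lam (p : c.P) : InteriorFunAt (fun y => Model.lam p (c.φ.symm y)) x := by
  refine interiorFunAt_of_chart hc hx
    (Model.smoothNonnegAt_of_lam_mul p (Model.smoothRealAt_const 1 _) ?_) ?_
  · filter_upwards [eventually_symm_chart hx] with t ht
    rw [ht, mul_one]
    exact ⟨one_pos, rfl⟩
  · filter_upwards [eventually_symm_chart hx] with t ht hi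
    rw [ht]
    exact hi p

/-- The interior germs given by the functions `λ_p` in a chart. -/
def chartHom : c.P →+ Additive (interiorGerms x) where
  toFun p := Additive.ofMul ⟨((fun y => Model.lam p (c.φ.symm y) : X → ℝ) : Germ (𝓝 x) ℝ),
    _, rfl, interiorFunAt_lam hc hx p⟩
  map_zero' := by
    refine congrArg Additive.ofMul (Subtype.ext ?_)
    simp only [Model.lam_zero]
    rfl
  map_add' p q := by
    refine congrArg Additive.ofMul (Subtype.ext ?_)
    simp only [Model.lam_add]
    rfl

lemma comap_chartHom_unitSub :
    (unitSub x).comap (chartHom hc hx) = Model.suppSub (c.φ.symm x) := by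
  ext p
  exact ⟨fun h => ne_of_gt h, Model.lam_pos_of_mem⟩

/-- This is the local form `λ_p · h`; the alternative that the germ is zero is excluded by the
density of the interior. -/
lemma exists_eq_add_chartHom (a : Additive (interiorGerms x)) :
    ∃ u ∈ unitSub x, ∃ p, a = u + chartHom hc hx p := by
  obtain ⟨_, b, rfl, hb⟩ := a
  obtain ⟨⟨U, hU, hu, ⟨p, h, hh, H⟩ | H⟩, hpos⟩ := hb c hc hx
  · have hsm : Model.SmoothRealAt h (c.φ.symm x) := ⟨U, hU, hu, hh⟩
    have hint : InteriorFunAt (fun y => h (c.φ.symm y)) x := by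
      refine interiorFunAt_of_chart hc hx (Model.smoothNonnegAt_of_lam_mul 0 hsm ?_) ?_
      · filter_upwards [eventually_symm_chart hx, hU.mem_nhds hu] with t ht htU
        rw [ht, Model.lam_zero, one_mul]
        exact ⟨(H t htU).1, rfl⟩
      · filter_upwards [eventually_symm_chart hx, hU.mem_nhds hu] with t ht htU _
        rw [ht]
        exact (H t htU).1
    refine ⟨Additive.ofMul ⟨_, _, rfl, hint⟩, (H _ hu).1, p, ?_⟩
    refine congrArg Additive.ofMul (Subtype.ext (Germ.coe_eq.2 ?_))
    have hev : ∀ᶠ y in 𝓝 x, c.φ.symm y ∈ U :=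
      (c.φ.continuousAt_symm hx).eventually (hU.mem_nhds hu)
    filter_upwards [hev, c.φ.open_target.mem_nhds hx] with y hy hyt
    have h1 : b (c.φ (c.φ.symm y)) = Model.lam p (c.φ.symm y) * h (c.φ.symm y) := (H _ hy).2
    rw [c.φ.right_inv hyt] at h1
    rw [h1, mul_comm]
  · obtain ⟨t, ⟨htU, ht⟩, hti⟩ := Model.exists_mem_interior c.weaklyToric.fg
      (inter_mem (hU.mem_nhds hu) hpos)
    exact absurd (H t htU) (ht hti).ne'

/-- The exponent `p` of a germ need not be unique, but morphisms vanishing on the support cannot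
detect the ambiguity. Hence germs modulo units and `P` modulo the support have the same duals. -/
lemma chartHom_wellDefined {u u' : Additive (interiorGerms x)} (hu : u ∈ unitSub x)
    (hu' : u' ∈ unitSub x) {p q : c.P} (h : u + chartHom hc hx p = u' + chartHom hc hx q)
    {α : c.P →+ ℝ} (hα : ∀ a ∈ Model.suppSub (c.φ.symm x), α a = 0) : α p = α q := by
  obtain ⟨_, a, rfl, ha⟩ := u
  obtain ⟨_, b, rfl, hb⟩ := u'
  have h : (fun y => a y * Model.lam p (c.φ.symm y)) =ᶠ[𝓝 x]
      fun y => b y * Model.lam q (c.φ.symm y) :=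
    Germ.coe_eq.1 (congrArg (fun z => (Additive.toMul z).1) h)
  have hcont : Tendsto c.φ (𝓝 (c.φ.symm x)) (𝓝 x) := by
    have := c.φ.continuousAt (c.φ.map_target hx)
    rwa [ContinuousAt, c.φ.right_inv hx] at this
  refine Model.eq_of_lam_mul_eq c.weaklyToric.fg (h := fun t => a (c.φ t))
    (h' := fun t => b (c.φ t)) (ha.continuousAt hc hx) (hb.continuousAt hc hx) ?_ ?_ ?_ hα
  · rw [c.φ.right_inv hx]
    exact hu
  · rw [c.φ.right_inv hx]
    exact hu'
  · filter_upwards [hcont.eventually h, eventually_symm_chart hx] with t ht hs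
    rw [hs] at ht
    rw [mul_comm, ht, mul_comm]

lemma exists_genBy_unitSub (x : X) : ∃ S, GenBy (unitSub x) S := by
  classical
  obtain ⟨c, hc, hx⟩ := ManifoldGC.covers x
  obtain ⟨S, hS⟩ := exists_genBy c.weaklyToric.fg
  refine ⟨S.image (chartHom hc hx), eq_top_iff.2 fun a _ => ?_⟩
  obtain ⟨u, hu, p, rfl⟩ := exists_eq_add_chartHom hc hx a
  refine AddSubmonoid.add_mem _ (AddSubmonoid.mem_sup_left hu) (AddSubmonoid.mem_sup_right ?_)
  rw [Finset.coe_image, ← AddMonoidHom.map_mclosure]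
  have hp : p ∈ AddSubmonoid.closure (S : Set c.P) := by
    rw [GenBy, bot_sup_eq] at hS
    rw [hS]
    exact AddSubmonoid.mem_top p
  exact ⟨p, hp, rfl⟩

/-! ### Duals of the germ monoid, and depth, computed in charts -/

variable {K : Type*} [Field K]

lemma annihComap_chartHom_injective {F : AddSubmonoid (Additive (interiorGerms x))}
    (hUF : unitSub x ≤ F) : Function.Injective (annihComap (K := K) (chartHom hc hx) F) := by
  intro α α' h
  refine Subtype.ext (AddMonoidHom.ext fun a => ?_)
  obtain ⟨u, hu, p, rfl⟩ := exists_eq_add_chartHom hc hx a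
  have h1 : α.1 (chartHom hc hx p) = α'.1 (chartHom hc hx p) :=
    DFunLike.congr_fun (congrArg Subtype.val h) p
  rw [map_add, map_add, h1, α.2 u (hUF hu), α'.2 u (hUF hu)]

/-- A morphism on `P` is transported by choosing an exponent for each germ. Independence of the
choice is known for real values, whence the embedding `i`. -/
lemma annihComap_chartHom_surjective (i : K →+* ℝ) {F : AddSubmonoid (Additive (interiorGerms x))}
    (hUF : unitSub x ≤ F) (hF : IsFace F) :
    Function.Surjective (annihComap (K := K) (chartHom hc hx) F) := by
  rintro ⟨α, hα⟩
  choose u hu p hp using exists_eq_add_chartHom hc hx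
  have wd : ∀ {u u' : Additive (interiorGerms x)} {p q : c.P}, u ∈ unitSub x → u' ∈ unitSub x →
      u + chartHom hc hx p = u' + chartHom hc hx q → α p = α q := by
    intro u u' p q hu hu' h
    refine i.injective (chartHom_wellDefined hc hx hu hu' h (α := i.toAddMonoidHom.comp α)
      fun a ha => ?_)
    rw [← comap_chartHom_unitSub hc hx] at ha
    change i (α a) = 0
    rw [hα a (hUF ha), map_zero]
  refine ⟨⟨AddMonoidHom.mk ⟨fun a => α (p a), ?_⟩ fun a b => ?_, fun a ha => ?_⟩,
    Subtype.ext (AddMonoidHom.ext fun q => ?_)⟩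
  · rw [← map_zero α]
    refine wd (hu 0) (unitSub x).zero_mem ?_
    rw [← hp, map_zero, add_zero]
  · change α (p (a + b)) = α (p a) + α (p b)
    rw [← map_add]
    refine wd (hu (a + b)) ((unitSub x).add_mem (hu a) (hu b)) ?_
    rw [← hp, map_add, add_add_add_comm, ← hp, ← hp]
  · rw [hp a] at ha
    exact hα _ (hF _ _ ha).2
  · refine wd (hu (chartHom hc hx q)) (unitSub x).zero_mem ?_
    rw [← hp, zero_add]

include hc hx in
lemma finite_annih_unitSub [CharZero K] : Module.Finite K (annih K (unitSub x)) := by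
  have := finiteDimensional_hom (K := K) c.P
  exact Module.Finite.of_injective _ (annihComap_chartHom_injective hc hx le_rfl)

lemma finrank_annih_chart (i : K →+* ℝ) {F : AddSubmonoid (Additive (interiorGerms x))}
    (hUF : unitSub x ≤ F) (hF : IsFace F) :
    Module.finrank K (annih K F) = Module.finrank K (annih K (F.comap (chartHom hc hx))) :=
  (LinearEquiv.ofBijective _ ⟨annihComap_chartHom_injective hc hx hUF,
    annihComap_chartHom_surjective hc hx i hUF hF⟩).finrank_eq

include hc hx in
/-- The depth may be computed in any chart. -/
lemma depth_eq_chart : depth x = Model.depth (c.φ.symm x) := by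
  -- The right-hand side makes no reference to the chart.
  have key : ∀ {c : GChart X} (_ : c ∈ ManifoldGC.atlas) (_ : x ∈ c.φ.target),
      Model.depth (c.φ.symm x) = Module.finrank ℝ (annih ℝ (unitSub x)) := by
    intro c hc hx
    rw [Model.depth_eq_finrank ℝ, ← comap_chartHom_unitSub hc hx,
      finrank_annih_chart hc hx (RingHom.id ℝ) le_rfl (isFace_unitSub x)]
  obtain ⟨h1, h2⟩ := Classical.choose_spec (ManifoldGC.covers x)
  rw [key hc hx, ← key h1 h2]
  rfl

end Chart

/-- Transport from the chart requires values in a field, so the integral morphism is moved over `ℚ`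
and denominators are then cleared. -/
lemma exists_posOff_unitSub (x : X) : ∃ β : Additive (interiorGerms x) →+ ℕ,
    PosOff β (unitSub x) := by
  obtain ⟨c, hc, hx⟩ := ManifoldGC.covers x
  obtain ⟨β, hβ⟩ := exists_posOff_nat c.weaklyToric.fg
    ((isFace_unitSub x).comap (chartHom hc hx))
  obtain ⟨⟨α, hα⟩, hαβ⟩ := annihComap_chartHom_surjective hc hx (Rat.castHom ℝ) le_rfl
    (isFace_unitSub x) ⟨(Nat.castAddMonoidHom ℚ).comp β, fun a ha => by
      rw [AddMonoidHom.comp_apply, hβ.1 a ha, map_zero]⟩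
  have hαβ : ∀ p, α (chartHom hc hx p) = β p := fun p =>
    DFunLike.congr_fun (congrArg Subtype.val hαβ) p
  obtain ⟨S, hS⟩ := exists_genBy_unitSub x
  have hpos : PosOff α (unitSub x) := ⟨hα, fun a ha => by
    obtain ⟨u, hu, p, rfl⟩ := exists_eq_add_chartHom hc hx a
    rw [map_add, hα u hu, zero_add, hαβ]
    exact_mod_cast hβ.2 p fun hp => ha ((unitSub x).add_mem hu hp)⟩
  obtain ⟨n, l, hn, hl⟩ := hS.exists_nat_multiple hpos.nonneg hα
  exact ⟨l, hpos.of_multiple hn hl⟩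

end

section

universe u v w

variable {X : Type u} [TopologicalSpace X] [ManifoldGC X] {Y : Type v} [TopologicalSpace Y]
  [ManifoldGC Y] {Z : Type w} [TopologicalSpace Z] [ManifoldGC Z]

/-! ## Local corner components -/

/-- A curve in `S^k(X)` tending to `x` determines a local `k`-corner component at `x`. -/
lemma exists_localCorner {k : ℕ} {x : X} {y : ℝ → X} {s₀ : ℝ} (hy : ContinuousOn y (Ici s₀))
    (hk : ∀ s, s₀ ≤ s → y s ∈ stratum X k) (ht : Tendsto y atTop (𝓝 x)) :
    ∃ γ : LocalCorner k x,
      ∀ V, IsOpen V → x ∈ V → ∀ᶠ s in atTop, y s ∈ γ.comp V := by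
  classical
  have hex : ∀ V, IsOpen V → x ∈ V → ∃ s₁, s₀ ≤ s₁ ∧ ∀ s, s₁ ≤ s → y s ∈ V ∩ stratum X k := by
    intro V hV hx
    obtain ⟨s₁, h⟩ := eventually_atTop.1 (ht.eventually (hV.mem_nhds hx))
    exact ⟨max s₀ s₁, le_max_left _ _, fun s hs =>
      ⟨h s ((le_max_right _ _).trans hs), hk s ((le_max_left _ _).trans hs)⟩⟩
  -- The component containing a tail of the curve. Tails are connected, and tails for different `V`
  -- overlap, so the choices are compatible.
  let comp : Set X → Set X := fun V =>
    if h : ∃ s₁, s₀ ≤ s₁ ∧ ∀ s, s₁ ≤ s → y s ∈ V ∩ stratum X k then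
      connectedComponentIn (V ∩ stratum X k) (y h.choose) else ∅
  have hcomp : ∀ V, IsOpen V → x ∈ V → ∃ s₁, (∀ s, s₁ ≤ s → y s ∈ V ∩ stratum X k) ∧
      comp V = connectedComponentIn (V ∩ stratum X k) (y s₁) ∧ ∀ s, s₁ ≤ s → y s ∈ comp V := by
    intro V hV hx
    have h := hex V hV hx
    have he : comp V = connectedComponentIn (V ∩ stratum X k) (y h.choose) := dif_pos h
    refine ⟨h.choose, h.choose_spec.2, he, fun s hs => ?_⟩
    rw [he]
    have hpre : IsPreconnected (y '' Ici h.choose) :=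
      isPreconnected_Ici.image y (hy.mono (Ici_subset_Ici.2 h.choose_spec.1))
    refine hpre.subset_connectedComponentIn (mem_image_of_mem y self_mem_Ici) ?_
      (mem_image_of_mem y hs)
    rintro _ ⟨s, hs, rfl⟩
    exact h.choose_spec.2 s hs
  have hev : ∀ V, IsOpen V → x ∈ V → ∀ᶠ s in atTop, y s ∈ comp V := by
    intro V hV hx
    obtain ⟨s₁, -, -, h⟩ := hcomp V hV hx
    exact eventually_atTop.2 ⟨s₁, h⟩
  refine ⟨⟨univ, isOpen_univ, mem_univ x, comp, fun V hV hx _ => ?_, fun V hV hx _ => ?_,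
    fun V V' hV hx _ hV' hx' _ => ?_⟩, hev⟩
  · obtain ⟨s₁, h1, h2, -⟩ := hcomp V hV hx
    exact ⟨y s₁, h1 s₁ le_rfl, h2⟩
  · exact mem_closure_of_tendsto ht (hev V hV hx)
  · exact mem_closure_of_tendsto ht ((hev V hV hx).and (hev V' hV' hx'))

/-- The support in a chart is constant on connected subsets of a stratum. -/
lemma suppSub_eq_of_isPreconnected {c : GChart X} (hc : c ∈ ManifoldGC.atlas) {k : ℕ} {W : Set X}
    (hW : IsPreconnected W) (hWc : W ⊆ c.φ.target) (hWk : W ⊆ stratum X k) {w w' : X} (hw : w ∈ W)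
    (hw' : w' ∈ W) : Model.suppSub (c.φ.symm w) = Model.suppSub (c.φ.symm w') := by
  have hdepth : ∀ w ∈ W, Model.depth (c.φ.symm w) = k := fun w hw => by
    rw [← depth_eq_chart hc (hWc hw)]
    exact hWk hw
  -- Supports can only grow at nearby points, and equal depth forbids strict growth.
  have hloc : IsLocallyConstant fun w : W => Model.suppSub (c.φ.symm w) := by
    rw [IsLocallyConstant.iff_eventually_eq]
    intro w
    have hcont : Tendsto (fun w : W => c.φ.symm w) (𝓝 w) (𝓝 (c.φ.symm w)) :=
      (c.φ.continuousAt_symm (hWc w.2)).tendsto.comp continuous_subtype_val.continuousAt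
    filter_upwards [hcont.eventually (Model.eventually_suppSub_le c.weaklyToric.fg _)] with w' hle
    exact (Model.suppSub_eq_of_le c.weaklyToric.fg hle
      (by rw [hdepth w w.2, hdepth w' w'.2])).symm
  have : PreconnectedSpace W := isPreconnected_iff_preconnectedSpace.1 hW
  exact hloc.apply_eq_of_isPreconnected isPreconnected_univ (x := ⟨w, hw⟩) (y := ⟨w', hw'⟩)
    (mem_univ _) (mem_univ _)

/-! ## b-normal maps -/

/-- The pullback of interior germs in additive notation. -/
def germPull (g : InteriorMap X Z) {x : X} {z : Z} (hx : g x = z) :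
    Additive (interiorGerms z) →+ Additive (interiorGerms x) :=
  MonoidHom.toAdditive (interiorPullback g hx)

lemma comap_germPull_unitSub (g : InteriorMap X Z) {x : X} {z : Z} (hx : g x = z) :
    (unitSub x).comap (germPull g hx) = unitSub z := by
  ext a
  change 0 < (interiorPullback g hx a.toMul).1.value ↔ 0 < a.toMul.1.value
  rw [value_interiorPullback]

/-- Near `x` the function `λ_q ∘ g` is a unit times `λ_p`, so both vanish at the same points. -/
lemma exists_eventually_mem_suppSub_iff (g : InteriorMap X Z) {x : X} {c : GChart X}
    (hc : c ∈ ManifoldGC.atlas) (hx : x ∈ c.φ.target) {d : GChart Z} (hd : d ∈ ManifoldGC.atlas)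
    (hz : g x ∈ d.φ.target) (q : d.P) :
    ∃ u ∈ unitSub x, ∃ p : c.P, germPull g rfl (chartHom hd hz q) = u + chartHom hc hx p ∧
      ∀ᶠ w in 𝓝 x, q ∈ Model.suppSub (d.φ.symm (g w)) ↔ p ∈ Model.suppSub (c.φ.symm w) := by
  obtain ⟨u, hu, p, hp⟩ := exists_eq_add_chartHom hc hx (germPull g rfl (chartHom hd hz q))
  refine ⟨u, hu, p, hp, ?_⟩
  obtain ⟨_, a, rfl, ha⟩ := u
  have hp : (fun w => Model.lam q (d.φ.symm (g w))) =ᶠ[𝓝 x]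
      fun w => a w * Model.lam p (c.φ.symm w) :=
    Germ.coe_eq.1 (congrArg (fun z => (Additive.toMul z).1) hp)
  have ha0 : ∀ᶠ t in 𝓝 (c.φ.symm x), 0 < a (c.φ t) :=
    (ha.continuousAt hc hx).eventually
      (lt_mem_nhds (show 0 < a (c.φ (c.φ.symm x)) by rw [c.φ.right_inv hx]; exact hu))
  filter_upwards [hp, (c.φ.continuousAt_symm hx).eventually ha0, c.φ.open_target.mem_nhds hx]
    with w hw haw hwt
  rw [c.φ.right_inv hwt] at haw
  rw [Model.mem_suppSub, Model.mem_suppSub, hw, mul_ne_zero_iff, and_iff_right haw.ne']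

/-- For a b-normal map the pullback of any face of the monoid of interior germs has at most the
codimension of that face. -/
lemma BNormal.finrank_annih_le {K : Type*} [Field K] [CharZero K] (i : K →+* ℝ)
    {g : InteriorMap X Z} (hg : BNormal g.toFun) {x : X} {z : Z} (hz : g x = z)
    {F : AddSubmonoid (Additive (interiorGerms x))} (hUF : unitSub x ≤ F) (hF : IsFace F) :
    Module.finrank K (annih K (F.comap (germPull g hz))) ≤ Module.finrank K (annih K F) := by
  subst hz
  obtain ⟨c, hc, hx⟩ := ManifoldGC.covers x
  obtain ⟨d, hd, hz⟩ := ManifoldGC.covers (g x)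
  have hF' := hF.comap (chartHom hc hx)
  have hsupp : Model.suppSub (c.φ.symm x) ≤ F.comap (chartHom hc hx) := by
    rw [← comap_chartHom_unitSub hc hx]
    exact fun p hp => hUF hp
  obtain ⟨L, hL⟩ := Model.exists_log (c.φ.symm x)
  obtain ⟨β, hβ⟩ := exists_posOff_nat c.weaklyToric.fg (Model.isFace_suppSub (c.φ.symm x))
  have ht := Model.tendsto_curve hF' hsupp hL hβ
  obtain ⟨s₀, hs₀⟩ := eventually_atTop.1
    (ht.eventually (c.φ.open_source.mem_nhds (c.φ.map_target hx)))
  have hleft : ∀ s, s₀ ≤ s → c.φ.symm (c.φ (Model.curve _ hF' L β s)) = Model.curve _ hF' L β s :=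
    fun s hs => c.φ.left_inv (hs₀ s hs)
  -- The curve stays in the stratum of `F`, whose depth is the codimension of `F`; it thus gives a
  -- corner component to which b-normality applies.
  obtain ⟨γ, hγs⟩ := exists_localCorner (k := Module.finrank K (annih K F)) (x := x)
    (y := fun s => c.φ (Model.curve _ hF' L β s)) (s₀ := s₀)
    (c.φ.continuousOn.comp (Model.continuous_curve hF' L β).continuousOn fun s hs => hs₀ s hs)
    (fun s hs => by
      change depth _ = _
      rw [depth_eq_chart hc (c.φ.map_source (hs₀ s hs)), hleft s hs, Model.depth_eq_finrank K,
        Model.suppSub_curve, ← finrank_annih_chart hc hx i hUF hF])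
    (by
      have := (c.φ.continuousAt (c.φ.map_target hx)).tendsto.comp ht
      rwa [c.φ.right_inv hx] at this)
  obtain ⟨j, hjk, δ, V₀, V₀', hV₀, hxV₀, hV₀γ, hV₀', hzV₀', hV₀δ, H⟩ := hg.corner_le _ x γ
  obtain ⟨T, hT⟩ := exists_genBy d.weaklyToric.fg
  choose u hu p hp hev using exists_eventually_mem_suppSub_iff g hc hx hd hz
  -- On `N` the support of `g w` is read off from that of `w`, since finitely many generators of
  -- `d.P` suffice.
  obtain ⟨N, hN, hNo, hxN⟩ := eventually_nhds_iff.1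
    ((Filter.eventually_all_finset T).2 fun q _ => hev q)
  have hVo : IsOpen (V₀ ∩ c.φ.target ∩ N) := (hV₀.inter c.φ.open_target).inter hNo
  have hV'o : IsOpen (V₀' ∩ d.φ.target) := hV₀'.inter d.φ.open_target
  have hxV : x ∈ V₀ ∩ c.φ.target ∩ N := ⟨⟨hxV₀, hx⟩, hxN⟩
  obtain ⟨_, hδ, w, hw, rfl⟩ := H _ _ hVo hxV (fun w hw => hw.1.1) hV'o ⟨hzV₀', hz⟩
    inter_subset_left
  obtain ⟨w₀, -, hw₀⟩ := γ.isComponent _ hVo hxV fun w hw => hV₀γ hw.1.1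
  obtain ⟨z₀, -, hz₀⟩ := δ.isComponent _ hV'o ⟨hzV₀', hz⟩ fun w hw => hV₀δ hw.1
  have hsub : γ.comp (V₀ ∩ c.φ.target ∩ N) ⊆
      (V₀ ∩ c.φ.target ∩ N) ∩ stratum X (Module.finrank K (annih K F)) := by
    rw [hw₀]
    exact connectedComponentIn_subset _ _
  have hδ' : g w ∈ (V₀' ∩ d.φ.target) ∩ stratum Z j := by
    rw [hz₀] at hδ
    exact connectedComponentIn_subset _ _ hδ
  -- The point `w` lies in the same component as a tail of the curve, and supports are constant on
  -- components.
  have hwF : Model.suppSub (c.φ.symm w) = F.comap (chartHom hc hx) := by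
    obtain ⟨s, hs, hs'⟩ := ((hγs _ hVo hxV).and (eventually_ge_atTop s₀)).exists
    rw [suppSub_eq_of_isPreconnected hc (by rw [hw₀]; exact isPreconnected_connectedComponentIn)
      (fun w hw => (hsub hw).1.1.2) (fun w hw => (hsub hw).2) hw hs, hleft s hs',
      Model.suppSub_curve]
  have hgF : Model.suppSub (d.φ.symm (g w)) =
      (F.comap (germPull g rfl)).comap (chartHom hd hz) := by
    refine hT.face_eq (Model.isFace_suppSub _) ((hF.comap _).comap _) bot_le bot_le fun q hq => ?_
    rw [hN w (hsub hw).1.2 q hq, hwF, AddSubmonoid.mem_comap, AddSubmonoid.mem_comap,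
      AddSubmonoid.mem_comap, hp q, hF.add_mem_iff, and_iff_right (hUF (hu q))]
  have hUF' : unitSub (g x) ≤ F.comap (germPull g rfl) := by
    rw [← comap_germPull_unitSub g rfl]
    exact fun a ha => hUF ha
  have hj : depth (g w) = j := hδ'.2
  rw [finrank_annih_chart hd hz i hUF' (hF.comap _), ← hgF, ← Model.depth_eq_finrank K,
    ← depth_eq_chart hd hδ'.1.2, hj]
  exact hjk

/-! ## c-transversality -/

/-- `ᵇÑ` is the space of real morphisms vanishing on the units, so this is the convex lifting result
with `F` the face of units. -/
lemma BNormal.bNormalMap_surjective {g : InteriorMap X Z} (hg : BNormal g.toFun) {x : X} {z : Z}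
    (hz : g x = z) : Function.Surjective (bNormalMap g hz) := by
  rintro ⟨y, hy⟩
  obtain ⟨c, hc, hx⟩ := ManifoldGC.covers x
  obtain ⟨d, hd, hzd⟩ := ManifoldGC.covers z
  obtain ⟨S, hS⟩ := exists_genBy_unitSub x
  obtain ⟨T, hT⟩ := exists_genBy_unitSub z
  have := finite_annih_unitSub (K := ℝ) hc hx
  have := finite_annih_unitSub (K := ℝ) hd hzd
  obtain ⟨β, hβ⟩ := exists_posOff_unitSub x
  have hβ' : PosOff ((Nat.castAddMonoidHom ℝ).comp β) (unitSub x) := hβ.cast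
  rw [← comap_germPull_unitSub g hz] at hT this
  obtain ⟨⟨α, hα⟩, h⟩ := hS.annihComap_surjective (germPull g hz) hT
    (fun F hUF hF => hg.finrank_annih_le (RingHom.id ℝ) hz hUF hF) (isFace_unitSub x) hβ'
    ⟨y, by rw [comap_germPull_unitSub]; exact hy⟩
  have h' : α.comp (germPull g hz) = y := congrArg Subtype.val h
  exact ⟨⟨α, hα⟩, Subtype.ext h'⟩

/-- If `g` is b-normal, the fibre product of the corner monoids contains interior elements. -/
lemma BNormal.exists_interior_fibre {g : InteriorMap X Z} (hg : BNormal g.toFun)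
    (h : InteriorMap Y Z) {x : X} {y : Y} {z : Z} (hx : g x = z) (hy : h y = z) :
    ∃ (l : Additive (interiorGerms x) →+ ℕ) (m : Additive (interiorGerms y) →+ ℕ),
      PosOff l (unitSub x) ∧ PosOff m (unitSub y) ∧
        l.comp (germPull g hx) = m.comp (germPull h hy) := by
  obtain ⟨c, hc, hxc⟩ := ManifoldGC.covers x
  obtain ⟨d, hd, hzd⟩ := ManifoldGC.covers z
  obtain ⟨S, hS⟩ := exists_genBy_unitSub x
  obtain ⟨T, hT⟩ := exists_genBy_unitSub z
  have := finite_annih_unitSub (K := ℚ) hc hxc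
  have := finite_annih_unitSub (K := ℚ) hd hzd
  obtain ⟨β, hβ⟩ := exists_posOff_unitSub x
  obtain ⟨m, hm⟩ := exists_posOff_unitSub y
  -- Pullback of germs preserves values and hence reflects units, so `m` pushed to `z` is still
  -- positive on all nonunits.
  have hm' := (hm.cast (K := ℚ)).comp (germPull h hy)
  rw [comap_germPull_unitSub, ← comap_germPull_unitSub g hx] at hm'
  rw [← comap_germPull_unitSub g hx] at hT this
  obtain ⟨α, hα, hαm⟩ := hS.exists_posOff_comp_eq (germPull g hx) hT
    (fun F hUF hF => hg.finrank_annih_le (Rat.castHom ℝ) hx hUF hF) le_rfl (isFace_unitSub x)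
    hβ.cast hm'
  obtain ⟨n, l, hn, hl⟩ := hS.exists_nat_multiple hα.nonneg hα.1
  -- Clearing denominators multiplies the lift by `n`, so `m` is multiplied by `n` as well.
  refine ⟨l, n • m, hα.of_multiple hn hl, ⟨fun a ha => ?_, fun a ha => ?_⟩, ?_⟩
  · rw [AddMonoidHom.nsmul_apply, hm.1 a ha, smul_zero]
  · rw [AddMonoidHom.nsmul_apply]
    exact nsmul_pos (hm.2 a ha) hn.ne'
  · ext a
    have h1 : α (germPull g hx a) = m (germPull h hy a) := DFunLike.congr_fun hαm a
    have h2 := hl (germPull g hx a)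
    rw [h1] at h2
    change l (germPull g hx a) = n • m (germPull h hy a)
    rw [smul_eq_mul]
    exact_mod_cast h2

/-- A face of the product of corner monoids which contains an interior element is everything. -/
lemma eq_top_of_posOff_mem {x : X} {y : Y} {F : AddSubmonoid (cornerMonoid x × cornerMonoid y)}
    (hF : IsFace F) {l : cornerMonoid x} {m : cornerMonoid y} (hl : PosOff l.1 (unitSub x))
    (hm : PosOff m.1 (unitSub y)) (h : (l, m) ∈ F) : F = ⊤ := by
  obtain ⟨S, hS⟩ := exists_genBy_unitSub x
  obtain ⟨T, hT⟩ := exists_genBy_unitSub y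
  refine eq_top_iff.2 ?_
  rintro ⟨a, b⟩ -
  obtain ⟨n, hn⟩ := hS.exists_add_eq_nsmul hl (a := a.1) fun u hu => a.2 u.toMul hu
  obtain ⟨n', hn'⟩ := hT.exists_add_eq_nsmul hm (a := b.1) fun u hu => b.2 u.toMul hu
  -- A common multiple is needed, as both coordinates must be dominated by one multiple of `(l, m)`.
  obtain ⟨a', ha', haa⟩ := hn (max n n') (le_max_left _ _)
  obtain ⟨b', hb', hbb⟩ := hn' (max n n') (le_max_right _ _)
  have hsum : (a, b) + ((⟨a', fun u hu => ha' _ hu⟩ : cornerMonoid x),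
      (⟨b', fun u hu => hb' _ hu⟩ : cornerMonoid y)) = max n n' • (l, m) :=
    Prod.ext (Subtype.ext haa) (Subtype.ext hbb)
  have hmem := F.nsmul_mem h (max n n')
  rw [← hsum] at hmem
  exact (hF _ _ hmem).1

theorem CTransverse.of_bNormal {g : InteriorMap X Z} {h : InteriorMap Y Z} (ht : BTransverse g h)
    (H : BNormal g.toFun ∨ BNormal h.toFun) : CTransverse g h where
  bTransverse := ht
  bNormal_surjective x y z hx hy a := by
    rcases H with H | H
    · obtain ⟨b, hb⟩ := H.bNormalMap_surjective hx a
      exact ⟨(b, 0), by rw [LinearMap.coprod_apply, hb, map_zero, add_zero]⟩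
    · obtain ⟨b, hb⟩ := H.bNormalMap_surjective hy a
      exact ⟨(0, b), by rw [LinearMap.coprod_apply, hb, map_zero, zero_add]⟩
  not_le_face x y z hx hy F hF hF' hle := by
    obtain ⟨l, m, hl, hm, hlm⟩ : ∃ (l : Additive (interiorGerms x) →+ ℕ)
        (m : Additive (interiorGerms y) →+ ℕ), PosOff l (unitSub x) ∧ PosOff m (unitSub y) ∧
        l.comp (germPull g hx) = m.comp (germPull h hy) := by
      rcases H with H | H
      · exact H.exists_interior_fibre h hx hy
      · obtain ⟨m, l, hm, hl, hml⟩ := H.exists_interior_fibre g hy hx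
        exact ⟨l, m, hl, hm, hml.symm⟩
    refine hF' (eq_top_of_posOff_mem (l := ⟨l, fun b hb => hl.1 _ hb⟩)
      (m := ⟨m, fun b hb => hm.1 _ hb⟩) hF hl hm (hle ?_))
    exact Subtype.ext hlm

/-! ### b-submersions are b-transverse to every interior map -/

lemma BSubmersion.bTransverse_left {g : InteriorMap X Z} (hg : BSubmersion g)
    (h : InteriorMap Y Z) : BTransverse g h := by
  rintro x y z rfl hy a
  obtain ⟨b, hb⟩ := hg x a
  exact ⟨(b, 0), by rw [LinearMap.coprod_apply, hb, map_zero, add_zero]⟩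

lemma BSubmersion.bTransverse_right (g : InteriorMap X Z) {h : InteriorMap Y Z}
    (hh : BSubmersion h) : BTransverse g h := by
  rintro x y z hx rfl a
  obtain ⟨b, hb⟩ := hh y a
  exact ⟨(0, b), by rw [LinearMap.coprod_apply, hb, map_zero, zero_add]⟩

end

end GCorners

end

theorem proposition4p25
    {X : Type*} {Y : Type*} {Z : Type*}
    [TopologicalSpace X] [GCorners.ManifoldGC X]
    [TopologicalSpace Y] [GCorners.ManifoldGC Y]
    [TopologicalSpace Z] [GCorners.ManifoldGC Z]
    (g : GCorners.InteriorMap X Z) (h : GCorners.InteriorMap Y Z)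
    (H : (GCorners.BTransverse g h ∧ (GCorners.BNormal g.toFun ∨ GCorners.BNormal h.toFun)) ∨
      (GCorners.BFibration g ∨ GCorners.BFibration h)) :
    GCorners.CTransverse g h := by
  rcases H with ⟨ht, H⟩ | ⟨hn, hs⟩ | ⟨hn, hs⟩
  · exact .of_bNormal ht H
  · exact .of_bNormal (hs.bTransverse_left h) (Or.inl hn)
  · exact .of_bNormal (hs.bTransverse_right g) (Or.inr hn)
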